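/- Let $\omega_1,\dots,\omega_n>0$ and, for $L=(L_1,\dots,L_n)$ with all $L_i>0$, let $\mathbb T_L=\prod_{i=1}^n(\mathbb R/L_i\mathbb Z)$, with volume $|\mathbb T_L|=L_1\cdots L_n$ and characters $e_m(x)=e^{2\pi i\,x\cdot\xi_m}$, where $\xi_m=(m_1/L_1,\dots,m_n/L_n)$ for $m\in\mathbb Z^n$. For real-valued $u\in L^1(\mathbb T_L)$ put $a_m=|\mathbb T_L|^{-1}\int_{\mathbb T_L}u\,e_{-m}\,dx$ and $$\|u\|_{\dot H^{-s}_{\mathrm{av}}}^2=|\mathbb T_L|\sum_{m\ne0}|\xi_m|^{-2s}|a_m|^2,\qquad (-\Delta)^{-s}u=\sum_{m\neq0}(2\pi|\xi_m|)^{-2s}a_m e_m,$$ $$TV(u)=\sup\Big\{-\int_{\mathbb T_L}u\,\operatorname{div}\Phi\,dx\;:\;\Phi\in C^\infty(\mathbb T_L;\mathbb R^n),\ |\Phi|\le1\Big\}.$$ Write $u\in\dot H^{-s}_{\mathrm{av}}(\mathbb T_L)$ if $a_0=0$ and $\|u\|_{\dot H^{-s}_{\mathrm{av}}}<\infty$,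 and $u\in BV(\mathbb T_L)$ if $u\in L^1$ and $TV(u)<\infty$. For a distribution $w$ on $\mathbb T_L$ and $\frac1p+\frac1{p'}=1$ put $$\|w\|_{\dot W^{-1,p}_{\mathrm{av}}}=\sup\Big\{\langle w,\varphi\rangle\;:\;\varphi\in C^1(\mathbb T_L;\mathbb R),\ \int_{\mathbb T_L}\varphi\,dx=0,\ \|\nabla\varphi\|_{L^{p'}}\le1\Big\}\in[0,\infty].$$ **Lemma.** Assume that $$1\le n\le2(s+1),\qquad 0<s\le1,\qquad 1\le p\le\infty,\qquad \tfrac12\le\theta\le1,$$ and that the scaling balance $$s+\frac n2=(1-\theta)\Big(2s+1+\frac np\Big)+\theta(n-1)$$ holds (with $n/p=0$ if $p=\infty$). Then there is a constant $C_*\in(0,\infty)$, depending only on $n,s,p,\theta$ and $\omega$, such that for every $\lambda>0$, with $L=\omega/\lambda$, $$\|u\|_{\dot H^{-s}_{\mathrm{av}}}\le C_*\,\big\|(-\Delta)^{-s}u\big\|_{\dot W^{-1,p}_{\mathrm{av}}}^{1-\theta}\,TV(u)^{\theta}\qquad\text{for all real-valued }u\in\dot H^{-s}_{\mathrm{av}}(\mathbb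 T_L)\cap BV(\mathbb T_L),$$ where a factor with exponent $0$ is read as $1$. The constant is thus invariant under dilation: it does not change when a function $u$ on $\mathbb T_\omega$ is replaced by $u_\lambda(x)=u(\lambda x)$, a function on $\mathbb T_{\omega/\lambda}$. -/

import Mathlib

open MeasureTheory
open scoped ENNReal NNReal

noncomputable section

/-- The flat torus `∏ i, ℝ / (L i) ℤ` with periods `L i > 0`. It carries its group structure and the
product Lebesgue measure, of total mass `∏ i, L i`. -/
abbrev FlatTorus {n : ℕ} (L : Fin n → ℝ) : Type := (i : Fin n) → AddCircle (L i)

namespace FlatTorus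

variable {n : ℕ} (L : Fin n → ℝ)

/-- The quotient map from Euclidean space onto the torus. -/
def proj (y : EuclideanSpace ℝ (Fin n)) : FlatTorus L := fun i => ((y i : ℝ) : AddCircle (L i))

/-- A map on the torus is of class `C^k` if its periodic lift to Euclidean space is. -/
def IsCk {F : Type*} [NormedAddCommGroup F] [NormedSpace ℝ F] (k : WithTop ℕ∞)
    (f : FlatTorus L → F) : Prop :=
  ContDiff ℝ k (fun y : EuclideanSpace ℝ (Fin n) => f (proj L y))

/-- The partial derivative of `f` at `x` in the direction of the `i`-th coordinate. -/
def pderiv (i : Fin n) (f : FlatTorus L → ℝ) (x : FlatTorus L) : ℝ :=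
  deriv (fun t : ℝ => f (x + Pi.single i ((t : ℝ) : AddCircle (L i)))) 0

/-- The gradient, with values in Euclidean space. -/
def grad (f : FlatTorus L → ℝ) (x : FlatTorus L) : EuclideanSpace ℝ (Fin n) :=
  WithLp.toLp 2 (fun i => pderiv L i f x)

/-- The divergence of a vector field. -/
def divergence (Φ : FlatTorus L → EuclideanSpace ℝ (Fin n)) (x : FlatTorus L) : ℝ :=
  ∑ i, pderiv L i (fun z => Φ z i) x

/-- The frequency `(m_1 / L_1, …, m_n / L_n)`, as a vector of Euclidean space. -/
def freq (m : Fin n → ℤ) : EuclideanSpace ℝ (Fin n) :=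
  WithLp.toLp 2 (fun i => (m i : ℝ) / L i)

/-- The character `e_m(x) = exp (2 π i ∑ j, m_j x_j / L_j)`. -/
def char (m : Fin n → ℤ) (x : FlatTorus L) : ℂ := ∏ i, fourier (m i) (x i)

/-- The total variation `sup { - ∫ u div Φ }` over smooth `Φ` with `|Φ| ≤ 1` everywhere. -/
def totalVariation [∀ i, Fact (0 < L i)] (u : FlatTorus L → ℝ) : ℝ≥0∞ :=
  ⨆ (Φ : FlatTorus L → EuclideanSpace ℝ (Fin n)) (_ : IsCk L ((⊤ : ℕ∞) : WithTop ℕ∞) Φ) (_ : ∀ x, ‖Φ x‖ ≤ 1),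
    ENNReal.ofReal (-∫ x, u x * divergence L Φ x)

/-- Functions of bounded variation. -/
def MemBV [∀ i, Fact (0 < L i)] (u : FlatTorus L → ℝ) : Prop :=
  Integrable u ∧ totalVariation L u < ∞

/-- The `m`-th Fourier coefficient `|T|⁻¹ ∫ u e_{-m}` of an integrable function. -/
def coeff [∀ i, Fact (0 < L i)] (u : FlatTorus L → ℝ) (m : Fin n → ℤ) : ℂ :=
  ((∏ i, L i : ℝ) : ℂ)⁻¹ * ∫ x, char L (-m) x * (u x : ℂ)

/-- The homogeneous Sobolev norm of order `σ` of a Fourier series `∑ m, a m • e_m`, namely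
`(|T| ∑_{m ≠ 0} |freq m| ^ (2 σ) |a m| ^ 2) ^ (1/2)`. The volume `|T| = ∏ i, L i` (which is `1` for unit
periods) makes this, up to a power of `2 π`, the `L²` norm of `(-Δ) ^ (σ/2)` of the series. -/
def hdotNorm (σ : ℝ) (a : (Fin n → ℤ) → ℂ) : ℝ≥0∞ :=
  (ENNReal.ofReal (∏ i, L i) *
    ∑' m : {m : Fin n → ℤ // m ≠ 0},
      ENNReal.ofReal (‖freq L m‖ ^ (2 * σ) * ‖a m‖ ^ 2)) ^ (1 / 2 : ℝ)

/-- The average-free homogeneous Sobolev space of order `σ`, as a set of Fourier series. -/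
def MemHdot (σ : ℝ) (a : (Fin n → ℤ) → ℂ) : Prop :=
  a 0 = 0 ∧ hdotNorm L σ a < ∞

/-- The fractional Laplacian `(-Δ) ^ σ` on average-free Fourier series: the Fourier multiplier
`(2 π |freq m|) ^ (2 σ)` for `m ≠ 0`. -/
def fracLaplacian (σ : ℝ) (a : (Fin n → ℤ) → ℂ) (m : Fin n → ℤ) : ℂ :=
  if m = 0 then 0 else (((2 * Real.pi * ‖freq L m‖) ^ (2 * σ) : ℝ) : ℂ) * a m

/-- The distributional pairing `⟨∑ m, b m • e_m, φ⟩ = ∑ m, b m ∫ e_m φ` with a real test function. The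
series is absolutely convergent when `b` is square summable and `φ` is continuous. -/
def pairing [∀ i, Fact (0 < L i)] (b : (Fin n → ℤ) → ℂ) (φ : FlatTorus L → ℝ) : ℂ :=
  ∑' m : Fin n → ℤ, b m * ∫ x, char L m x * (φ x : ℂ)

/-- The homogeneous negative Sobolev norm: the supremum of `⟨w, φ⟩` over average-free `φ` of class `C^1`
with `‖∇φ‖_{L^{p'}} ≤ 1`, where `1/p + 1/p' = 1`. For a real distribution `w` the pairing is
real. -/
def wdotNegNorm [∀ i, Fact (0 < L i)] (p : ℝ≥0∞) (b : (Fin n → ℤ) → ℂ) : ℝ≥0∞ :=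
  ⨆ (φ : FlatTorus L → ℝ) (_ : IsCk L 1 φ) (_ : ∫ x, φ x = 0)
    (_ : eLpNorm (grad L φ) (ENNReal.conjExponent p) volume ≤ 1),
    ENNReal.ofReal (pairing L b φ).re

end FlatTorus

end

noncomputable section

namespace FlatTorus

/-! ### Characters and real trigonometric polynomials on the torus. -/

section

variable {n : ℕ} (L : Fin n → ℝ)

/-! Write `T` for the total variation of `u`, `W` for the dual norm of `(-Δ)^{-s} u`, `X` for the
squared norm of order `-s`, and `b = 2s + 2 - n ≥ 0`. The scaling balance is equivalent to `(1 - θ)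
n/p = (θ - 1/2) b`. Let `ℓ` be the shortest period; all periods are comparable to `ℓ`, with a ratio
that depends on `ω` alone. Bounds for `X` that use only `ℓ` and this ratio are therefore uniform
under dilation.

Low frequencies, `|m| ≤ N`: pair `(-Δ)^{-s} u` with the test function `K * u`, where `K` is a Fejér
kernel whose coefficients are nonnegative everywhere and at least `2^{-n}` for `|m| ≤ N`. By
Parseval the pairing dominates the low part of `X`. By duality it is at most `W ‖∇(K * u)‖_{p'}`.
Moving `K` onto the test field bounds `∇(K * u)` by `T` in `L¹` and by `T sup K / |T_L|` in `L^∞`,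
so the low part is at most a constant times `T W (N/ℓ)^{n/p}` (`sum_low_le`,
`partialEnergy_low_le`).

High frequencies, when `b > 0`: the decay `|a_m| ≤ T / (2π |ξ_m| |T_L|)` makes the tail of `X` a
lattice sum of `|ξ_m|^{-(n+b)}`, of size `T² (ℓ/N)^b` (`partialEnergy_high_le`). The choice `N/ℓ ≈
(T/W)^{1/(n/p+b)}` equalizes the two parts, and the balance turns their common value into
`W^{2(1-θ)} T^{2θ}` (`le_of_forall_split`).

The critical case `b = 0`: the tail sum diverges, but the balance forces `θ = 1` or `p = ∞`. The
bound `X ≤ C T²` is now the endpoint embedding of BV, obtained from the Gagliardo–Nirenberg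
inequality (BV into `L^{n/(n-1)}`) and the dual of the Sobolev embedding of order `(n-2)/2` into
`L^n` (`IsTrig.sum_le_critical`). If `p = ∞`, the low-frequency bound contains no power of `N` and
gives `X ≤ C T W` outright; interpolating between the two bounds finishes the proof. -/

theorem char_add (m : Fin n → ℤ) (x y : FlatTorus L) :
    char L m (x + y) = char L m x * char L m y := by
  simp only [char, ← Finset.prod_mul_distrib, Pi.add_apply]
  refine Finset.prod_congr rfl fun i _ => ?_
  simp [fourier_apply, smul_add, AddCircle.toCircle_add]

theorem char_add_index (m k : Fin n → ℤ) (x : FlatTorus L) :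
    char L (m + k) x = char L m x * char L k x := by
  simp only [char, ← Finset.prod_mul_distrib, Pi.add_apply, fourier_add]

theorem char_neg_index (m : Fin n → ℤ) (x : FlatTorus L) :
    char L (-m) x = starRingEnd ℂ (char L m x) := by
  simp only [char, map_prod, Pi.neg_apply, fourier_neg]

theorem char_sub_index (m k : Fin n → ℤ) (x : FlatTorus L) :
    char L (m - k) x = char L m x * starRingEnd ℂ (char L k x) := by
  rw [sub_eq_add_neg, char_add_index, char_neg_index]

theorem char_neg (m : Fin n → ℤ) (x : FlatTorus L) :
    char L m (-x) = char L (-m) x := by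
  simp only [char, Pi.neg_apply]
  refine Finset.prod_congr rfl fun i _ => ?_
  simp only [fourier_apply]
  congr 2
  simp

@[simp] theorem char_zero_index (x : FlatTorus L) : char L 0 x = 1 := by
  simp [char]

@[simp] theorem norm_char (m : Fin n → ℤ) (x : FlatTorus L) : ‖char L m x‖ = 1 := by
  rw [char, norm_prod]
  exact Finset.prod_eq_one fun i _ => by rw [fourier_apply]; exact Circle.norm_coe _

theorem continuous_char (m : Fin n → ℤ) : Continuous (char L m) := by
  unfold char
  fun_prop

theorem char_single (m : Fin n → ℤ) (i : Fin n) (t : ℝ) :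
    char L m (Pi.single i (t : AddCircle (L i))) =
      Complex.exp (2 * Real.pi * Complex.I * m i * t / L i) := by
  rw [char, Finset.prod_eq_single i]
  · rw [Pi.single_eq_same, fourier_coe_apply]
  · intro j _ hj
    rw [Pi.single_eq_of_ne hj]
    exact fourier_eval_zero _
  · simp

/-- The multiplier `2 π i m_j / L_j` of the `j`-th partial derivative. -/
def dmult (i : Fin n) (m : Fin n → ℤ) : ℂ := 2 * Real.pi * Complex.I * m i / L i

theorem hasDerivAt_char (m : Fin n → ℤ) (i : Fin n) (x : FlatTorus L) (t : ℝ) :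
    HasDerivAt (fun t : ℝ => char L m (x + Pi.single i (t : AddCircle (L i))))
      (dmult L i m * char L m (x + Pi.single i (t : AddCircle (L i)))) t := by
  simp only [char_add, char_single]
  have h1 : HasDerivAt (fun t : ℝ => (2 * Real.pi * Complex.I * m i * t / L i : ℂ))
      (dmult L i m) t := by
    have := ((hasDerivAt_id t).ofReal_comp.const_mul (2 * Real.pi * Complex.I * m i : ℂ)).div_const
      (L i : ℂ)
    simpa [dmult] using this
  rw [mul_left_comm, mul_comm (dmult L i m)]
  exact (h1.cexp).const_mul (char L m x)

theorem isCk_char (k : WithTop ℕ∞) (m : Fin n → ℤ) : IsCk L k (char L m) := by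
  unfold IsCk char proj
  simp only [fourier_coe_apply]
  refine contDiff_prod fun i _ => ?_
  have h : ContDiff ℝ k fun y : EuclideanSpace ℝ (Fin n) => ((y i : ℝ) : ℂ) :=
    Complex.ofRealCLM.contDiff.comp (by fun_prop)
  exact ((contDiff_const.mul h).div_const _).cexp

/-- `f` is the real-valued trigonometric polynomial with frequencies in `S` and coefficients `c`. -/
def IsTrig (S : Finset (Fin n → ℤ)) (c : (Fin n → ℤ) → ℂ) (f : FlatTorus L → ℝ) : Prop :=
  ∀ x, (f x : ℂ) = ∑ m ∈ S, c m * char L m x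

variable {L}

variable (L) in
/-- `f` is the real part of the trigonometric polynomial with frequencies in `S` and coefficients
`c`. -/
def IsReTrig (S : Finset (Fin n → ℤ)) (c : (Fin n → ℤ) → ℂ) (f : FlatTorus L → ℝ) : Prop :=
  ∀ x, f x = (∑ m ∈ S, c m * char L m x).re

theorem IsTrig.isReTrig {S : Finset (Fin n → ℤ)} {c : (Fin n → ℤ) → ℂ} {f : FlatTorus L → ℝ}
    (h : IsTrig L S c f) : IsReTrig L S c f := fun x => by
  rw [← h x, Complex.ofReal_re]

theorem IsReTrig.continuous {S : Finset (Fin n → ℤ)} {c : (Fin n → ℤ) → ℂ} {f : FlatTorus L → ℝ}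
    (h : IsReTrig L S c f) : Continuous f := by
  rw [funext h]
  refine Complex.continuous_re.comp (continuous_finsetSum _ fun m _ => ?_)
  exact continuous_const.mul (continuous_char L m)

theorem IsTrig.continuous {S : Finset (Fin n → ℤ)} {c : (Fin n → ℤ) → ℂ} {f : FlatTorus L → ℝ}
    (h : IsTrig L S c f) : Continuous f := h.isReTrig.continuous

theorem IsReTrig.isCk {S : Finset (Fin n → ℤ)} {c : (Fin n → ℤ) → ℂ} {f : FlatTorus L → ℝ}
    (h : IsReTrig L S c f) (k : WithTop ℕ∞) : IsCk L k f := by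
  rw [funext h]
  refine Complex.reCLM.contDiff.comp (ContDiff.sum fun m _ => ?_)
  exact contDiff_const.mul (isCk_char L k m)

theorem IsReTrig.hasDerivAt_aux {S : Finset (Fin n → ℤ)} {c : (Fin n → ℤ) → ℂ} {f : FlatTorus L → ℝ}
    (h : IsReTrig L S c f) (i : Fin n) (x : FlatTorus L) (t : ℝ) :
    HasDerivAt (fun t : ℝ => f (x + Pi.single i (t : AddCircle (L i))))
      (∑ m ∈ S, c m * (dmult L i m * char L m (x + Pi.single i (t : AddCircle (L i))))).re t := by
  have h1 : HasDerivAt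
      (fun t : ℝ => ∑ m ∈ S, c m * char L m (x + Pi.single i (t : AddCircle (L i))))
      (∑ m ∈ S, c m * (dmult L i m * char L m (x + Pi.single i (t : AddCircle (L i))))) t :=
    HasDerivAt.fun_sum fun m _ => (hasDerivAt_char L m i x t).const_mul (c m)
  have h2 := Complex.reCLM.hasFDerivAt.comp_hasDerivAt t h1
  simp only [h _]
  exact h2

theorem IsReTrig.reTrig_pderiv {S : Finset (Fin n → ℤ)} {c : (Fin n → ℤ) → ℂ} {f : FlatTorus L → ℝ}
    (h : IsReTrig L S c f) (i : Fin n) :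
    IsReTrig L S (fun m => dmult L i m * c m) (pderiv L i f) := by
  intro x
  have h2 := (h.hasDerivAt_aux i x 0).deriv
  rw [FlatTorus.pderiv, h2]
  congr 1
  refine Finset.sum_congr rfl fun m _ => ?_
  simp only [AddCircle.coe_zero, Pi.single_zero, add_zero]
  ring

theorem IsReTrig.hasDerivAt {S : Finset (Fin n → ℤ)} {c : (Fin n → ℤ) → ℂ} {f : FlatTorus L → ℝ}
    (h : IsReTrig L S c f) (i : Fin n) (x : FlatTorus L) (t : ℝ) :
    HasDerivAt (fun t : ℝ => f (x + Pi.single i (t : AddCircle (L i))))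
      (FlatTorus.pderiv L i f (x + Pi.single i (t : AddCircle (L i)))) t := by
  convert h.hasDerivAt_aux i x t using 1
  rw [h.reTrig_pderiv i]
  congr 1
  refine Finset.sum_congr rfl fun m _ => by ring

theorem IsTrig.trig_pderiv {S : Finset (Fin n → ℤ)} {c : (Fin n → ℤ) → ℂ}
    {f : FlatTorus L → ℝ} (h : IsTrig L S c f) (i : Fin n) :
    IsTrig L S (fun m => dmult L i m * c m) (pderiv L i f) := by
  intro x
  have h1 : HasDerivAt
      (fun t : ℝ => ∑ m ∈ S, c m * char L m (x + Pi.single i (t : AddCircle (L i))))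
      (∑ m ∈ S, c m * (dmult L i m * char L m
        (x + Pi.single i ((0 : ℝ) : AddCircle (L i))))) 0 :=
    HasDerivAt.fun_sum fun m _ => (hasDerivAt_char L m i x 0).const_mul (c m)
  have h2 : HasDerivAt (fun t : ℝ => f (x + Pi.single i (t : AddCircle (L i))))
      (FlatTorus.pderiv L i f x) 0 := (h.isReTrig.hasDerivAt_aux i x 0).differentiableAt.hasDerivAt
  have h3 := h2.ofReal_comp
  simp only [h _] at h3
  rw [h3.unique h1]
  refine Finset.sum_congr rfl fun m _ => ?_
  simp only [AddCircle.coe_zero, Pi.single_zero, add_zero]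
  ring

theorem dmult_eq (i : Fin n) (m : Fin n → ℤ) :
    dmult L i m = 2 * Real.pi * Complex.I * (freq L m i : ℝ) := by
  simp only [dmult, freq]
  push_cast
  ring

theorem dmult_neg (i : Fin n) (m : Fin n → ℤ) : dmult L i (-m) = -dmult L i m := by
  simp only [dmult, Pi.neg_apply]
  push_cast
  ring

theorem conj_dmult (i : Fin n) (m : Fin n → ℤ) :
    starRingEnd ℂ (dmult L i m) = -dmult L i m := by
  simp only [dmult, map_div₀, map_mul, map_ofNat, Complex.conj_ofReal, Complex.conj_I, map_intCast]
  ring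

theorem isCk_of_isReTrig {S : Finset (Fin n → ℤ)} {c : Fin n → (Fin n → ℤ) → ℂ}
    {Φ : FlatTorus L → EuclideanSpace ℝ (Fin n)} (h : ∀ i, IsReTrig L S (c i) (fun x => Φ x i))
    (k : WithTop ℕ∞) : IsCk L k Φ := by
  unfold IsCk
  rw [contDiff_euclidean]
  exact fun i => (h i).isCk k

variable [∀ i, Fact (0 < L i)]

theorem period_pos (i : Fin n) : 0 < L i := Fact.out

variable (L) in
/-- The volume of the torus. -/
def vol : ℝ := ∏ i, L i

theorem vol_pos : 0 < vol L := Finset.prod_pos fun i _ => period_pos i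

variable (L) in
theorem volume_univ : (volume : Measure (FlatTorus L)) Set.univ = ENNReal.ofReal (vol L) := by
  rw [MeasureTheory.volume_pi, Measure.pi_univ]
  simp only [AddCircle.measure_univ]
  rw [vol, ENNReal.ofReal_prod_of_nonneg fun i _ => (period_pos i).le]

variable (L) in
theorem volume_real_univ : (volume : Measure (FlatTorus L)).real Set.univ = vol L := by
  rw [Measure.real, volume_univ, ENNReal.toReal_ofReal vol_pos.le]

theorem integrable_of_continuous {F : Type*} [NormedAddCommGroup F] (ν : Measure (FlatTorus L))
    [IsFiniteMeasure ν] {f : FlatTorus L → F} (hf : Continuous f) : Integrable f ν := by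
  rw [← integrableOn_univ]
  exact hf.continuousOn.integrableOn_compact isCompact_univ

variable (L) in
theorem integral_char (m : Fin n → ℤ) :
    ∫ x, char L m x = if m = 0 then (vol L : ℂ) else 0 := by
  split_ifs with h
  · subst h
    simp [volume_real_univ]
  · obtain ⟨i, hi⟩ := Function.ne_iff.mp h
    have hi' : m i ≠ 0 := hi
    -- A half period of the character in direction `i`, where it equals `-1`; translation invariance
    -- then makes the integral equal to its own negative.
    set y : FlatTorus L := Pi.single i ((L i / (2 * m i) : ℝ) : AddCircle (L i))
    have hy : char L m y = -1 := by
      rw [char_single, ← Complex.exp_pi_mul_I]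
      congr 1
      have h1 : (L i : ℂ) ≠ 0 := by exact_mod_cast (period_pos (L := L) i).ne'
      have h2 : (m i : ℂ) ≠ 0 := by exact_mod_cast hi'
      push_cast
      field_simp
    have h1 : ∫ x, char L m (x + y) = ∫ x, char L m x := integral_add_right_eq_self _ y
    simp only [char_add, hy, integral_mul_const] at h1
    have h2 : (2 : ℂ) * ∫ x, char L m x = 0 := by linear_combination -h1
    simpa using h2

theorem IsTrig.integral_char_mul {S : Finset (Fin n → ℤ)} {c : (Fin n → ℤ) → ℂ}
    {f : FlatTorus L → ℝ} (h : IsTrig L S c f) (k : Fin n → ℤ) :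
    ∫ x, char L k x * (f x : ℂ) = vol L * (if -k ∈ S then c (-k) else 0) := by
  simp only [h _, Finset.mul_sum]
  rw [integral_finsetSum]
  · have : ∀ m ∈ S, ∫ x, char L k x * (c m * char L m x) = 
        if -k = m then (vol L : ℂ) * c m else 0 := by
      intro m _
      have h1 : ∀ x, char L k x * (c m * char L m x) = c m * char L (k + m) x := by
        intro x; rw [char_add_index]; ring
      simp only [h1, integral_const_mul, integral_char]
      have h2 : k + m = 0 ↔ -k = m := by rw [neg_eq_iff_add_eq_zero]
      simp only [h2]
      split_ifs <;> ring
    rw [Finset.sum_congr rfl this, Finset.sum_ite_eq]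
    split_ifs <;> simp
  · intro m _
    exact integrable_of_continuous _
      ((continuous_char L k).mul (continuous_const.mul (continuous_char L m)))

theorem IsTrig.integral_eq {S : Finset (Fin n → ℤ)} {c : (Fin n → ℤ) → ℂ}
    {f : FlatTorus L → ℝ} (h : IsTrig L S c f) :
    ((∫ x, f x : ℝ) : ℂ) = vol L * (if 0 ∈ S then c 0 else 0) := by
  have := h.integral_char_mul 0
  simp only [char_zero_index, one_mul, neg_zero] at this
  rw [← this, integral_complex_ofReal]

end

/-! ### Total variation, decay of Fourier coefficients, and the Fejér kernel. -/

section

variable {n : ℕ} {L : Fin n → ℝ} [∀ i, Fact (0 < L i)] {u : FlatTorus L → ℝ}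

variable (L) in
/-- The total variation as a real number. -/
def tv (u : FlatTorus L → ℝ) : ℝ := (totalVariation L u).toReal

theorem tv_nonneg : 0 ≤ tv L u := ENNReal.toReal_nonneg

/-- Homogeneity of the supremum that defines the total variation. Since `B` may vanish, the field is
divided by an arbitrary `D > B`, and `D` is then lowered to `B`. -/
theorem neg_integral_divergence_le (hu : MemBV L u) {Φ : FlatTorus L → EuclideanSpace ℝ (Fin n)}
    (hΦ : IsCk L ((⊤ : ℕ∞) : WithTop ℕ∞) Φ) {B : ℝ} (hB : ∀ x, ‖Φ x‖ ≤ B) :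
    -∫ x, u x * divergence L Φ x ≤ B * tv L u := by
  have hB0 : 0 ≤ B := (norm_nonneg _).trans (hB 0)
  have key : ∀ D : ℝ, B < D → -∫ x, u x * divergence L Φ x ≤ D * tv L u := by
    intro D hD
    have hD0 : 0 < D := hB0.trans_lt hD
    have h1 : ENNReal.ofReal (-∫ x, u x * divergence L (fun x => D⁻¹ • Φ x) x) ≤
        totalVariation L u := by
      unfold totalVariation
      refine le_iSup_of_le (fun x => D⁻¹ • Φ x) (le_iSup_of_le ?_ (le_iSup_of_le ?_ le_rfl))
      · exact ContDiff.const_smul D⁻¹ hΦ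
      · intro x
        rw [norm_smul, norm_inv, Real.norm_of_nonneg hD0.le, inv_mul_le_iff₀ hD0, mul_one]
        exact (hB x).trans hD.le
    have h2 : ∀ x, divergence L (fun x => D⁻¹ • Φ x) x = D⁻¹ * divergence L Φ x := by
      intro x
      simp only [divergence, pderiv, Finset.mul_sum, PiLp.smul_apply, smul_eq_mul,
        deriv_const_mul_field]
    have h3 := (ENNReal.ofReal_le_iff_le_toReal hu.2.ne).1 h1
    have h5 : ∀ x, u x * (D⁻¹ * divergence L Φ x) = D⁻¹ * (u x * divergence L Φ x) := fun x => by ring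
    simp only [h2, h5, integral_const_mul] at h3
    rw [← mul_neg, inv_mul_le_iff₀ hD0] at h3
    exact h3
  refine le_of_forall_pos_le_add fun ε hε => ?_
  have hT := tv_nonneg (u := u)
  have h4 : 0 < ε / (tv L u + 1) := by positivity
  refine (key (B + ε / (tv L u + 1)) (by linarith)).trans ?_
  rw [add_mul]
  gcongr
  rw [div_mul_eq_mul_div, div_le_iff₀ (by positivity)]
  nlinarith

theorem integrable_char_mul (hu : Integrable u) (m : Fin n → ℤ) :
    Integrable fun x => char L m x * (u x : ℂ) := by
  refine hu.ofReal.bdd_mul (c := 1) (continuous_char L m).aestronglyMeasurable ?_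
  exact Filter.Eventually.of_forall fun x => by simp

theorem integral_char_mul_eq (m : Fin n → ℤ) :
    ∫ x, char L m x * (u x : ℂ) = vol L * coeff L u (-m) := by
  have h : (vol L : ℂ) ≠ 0 := by exact_mod_cast (vol_pos (L := L)).ne'
  rw [coeff, neg_neg, ← vol, mul_inv_cancel_left₀ h]

theorem coeff_neg (m : Fin n → ℤ) : coeff L u (-m) = starRingEnd ℂ (coeff L u m) := by
  have h : ∫ x, char L m x * (u x : ℂ) = starRingEnd ℂ (∫ x, char L (-m) x * (u x : ℂ)) := by
    rw [← integral_conj]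
    refine integral_congr_ae (Filter.Eventually.of_forall fun x => ?_)
    simp [char_neg_index]
  simp only [coeff, neg_neg, map_mul, h, map_inv₀, Complex.conj_ofReal]

theorem integral_mul_of_isReTrig (hu : Integrable u) {S : Finset (Fin n → ℤ)}
    {c : (Fin n → ℤ) → ℂ} {f : FlatTorus L → ℝ} (h : IsReTrig L S c f) :
    ∫ x, u x * f x = (∑ m ∈ S, c m * (vol L * coeff L u (-m))).re := by
  have h1 : ∀ x, u x * f x = (∑ m ∈ S, c m * (char L m x * (u x : ℂ))).re := by
    intro x
    rw [h x]
    simp only [← mul_assoc, ← Finset.sum_mul, Complex.re_mul_ofReal]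
    ring
  have h2 : Integrable fun x => ∑ m ∈ S, c m * (char L m x * (u x : ℂ)) :=
    integrable_finsetSum _ fun m _ => (integrable_char_mul hu m).const_mul _
  simp only [h1]
  have h3 := Complex.reCLM.integral_comp_comm h2
  simp only [Complex.reCLM_apply] at h3
  rw [h3, integral_finsetSum _ fun m _ => (integrable_char_mul hu m).const_mul _]
  simp only [integral_const_mul, integral_char_mul_eq]

theorem integral_mul_divergence (hu : Integrable u) {S : Finset (Fin n → ℤ)}
    {c : Fin n → (Fin n → ℤ) → ℂ}
    {Φ : FlatTorus L → EuclideanSpace ℝ (Fin n)} (h : ∀ i, IsReTrig L S (c i) (fun x => Φ x i)) :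
    ∫ x, u x * divergence L Φ x =
      (∑ m ∈ S, (∑ i, dmult L i m * c i m) * (vol L * coeff L u (-m))).re := by
  refine integral_mul_of_isReTrig hu fun x => ?_
  simp only [divergence, (h _).reTrig_pderiv _ x, Finset.sum_mul, ← Complex.re_sum]
  rw [Finset.sum_comm]

variable (L) in
theorem freq_ne_zero {m : Fin n → ℤ} (hm : m ≠ 0) : freq L m ≠ 0 := by
  obtain ⟨i, hi⟩ := Function.ne_iff.mp hm
  intro h
  have h1 : freq L m i = 0 := by rw [h]; rfl
  have h2 : (m i : ℝ) / L i = 0 := h1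
  have := (period_pos (L := L) i).ne'
  simp_all

variable (L) in
theorem norm_freq_pos {m : Fin n → ℤ} (hm : m ≠ 0) : 0 < ‖freq L m‖ :=
  norm_pos_iff.2 (freq_ne_zero L hm)

/-- The extremal test is a plane wave of frequency `m` pointing along `ξ_m`: its divergence is `2π
|ξ_m|` times a character, up to phase, and its length is at most one. -/
theorem norm_coeff_le (hu : MemBV L u) {m : Fin n → ℤ} (hm : m ≠ 0) :
    2 * Real.pi * ‖freq L m‖ * (vol L * ‖coeff L u m‖) ≤ tv L u := by
  obtain ⟨z, hz, hza⟩ : ∃ z : ℂ, ‖z‖ = 1 ∧ z * coeff L u m = ‖coeff L u m‖ := by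
    by_cases h : coeff L u m = 0
    · exact ⟨1, by simp [h]⟩
    · refine ⟨starRingEnd ℂ (coeff L u m) / ‖coeff L u m‖, ?_, ?_⟩
      · have : ‖coeff L u m‖ ≠ 0 := by simpa using h
        simp [this]
      · have : (‖coeff L u m‖ : ℂ) ≠ 0 := by simpa using h
        rw [div_mul_eq_mul_div, div_eq_iff this, mul_comm, Complex.mul_conj, Complex.normSq_eq_norm_sq]
        push_cast; ring
  have hf := norm_freq_pos L hm
  -- The phase `z` makes the coefficient real and nonnegative; the factor `-I` cancels the `I`
  -- produced by differentiation.
  set w : ℂ := -Complex.I * z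
  have hw : ‖w‖ = 1 := by simp [w, hz]
  let Φ : FlatTorus L → EuclideanSpace ℝ (Fin n) := fun x =>
    ((w * char L (-m) x).re / ‖freq L m‖) • freq L m
  have hΦ : ∀ i, IsReTrig L {-m} (fun _ => w * ((freq L m i / ‖freq L m‖ : ℝ) : ℂ))
      (fun x => Φ x i) := by
    intro i x
    simp only [Φ, PiLp.smul_apply, smul_eq_mul, Finset.sum_singleton]
    have : w * ((freq L m i / ‖freq L m‖ : ℝ) : ℂ) * char L (-m) x =
        w * char L (-m) x * ((freq L m i / ‖freq L m‖ : ℝ) : ℂ) := by ring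
    rw [this, Complex.re_mul_ofReal]
    ring
  have hB : ∀ x, ‖Φ x‖ ≤ 1 := by
    intro x
    simp only [Φ]
    rw [norm_smul, norm_div, norm_norm, div_mul_cancel₀ _ hf.ne']
    refine (Complex.abs_re_le_norm _).trans ?_
    simp [hw]
  have h1 := neg_integral_divergence_le hu (isCk_of_isReTrig hΦ _) hB
  rw [integral_mul_divergence hu.1 hΦ, one_mul, Finset.sum_singleton, neg_neg] at h1
  refine le_trans (le_of_eq ?_) h1
  have h2 : ∑ i, dmult L i (-m) * (w * ((freq L m i / ‖freq L m‖ : ℝ) : ℂ)) =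
      -(2 * Real.pi * Complex.I) * w * ‖freq L m‖ := by
    have h3 : ∑ i, (freq L m i) ^ 2 = ‖freq L m‖ ^ 2 := by
      rw [EuclideanSpace.norm_sq_eq]; simp
    have h4 : ∀ i, dmult L i (-m) * (w * ((freq L m i / ‖freq L m‖ : ℝ) : ℂ)) =
        -(2 * Real.pi * Complex.I) * w * ((freq L m i ^ 2 / ‖freq L m‖ : ℝ) : ℂ) := by
      intro i
      rw [dmult_neg, dmult_eq]
      push_cast
      ring
    simp only [h4, ← Finset.mul_sum, ← Complex.ofReal_sum, ← Finset.sum_div, h3]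
    congr 2
    field_simp
  rw [h2]
  have h5 : -(2 * Real.pi * Complex.I) * w * ‖freq L m‖ * (vol L * coeff L u m) =
      -((2 * Real.pi * ‖freq L m‖ * (vol L * ‖coeff L u m‖) : ℝ) : ℂ) := by
    push_cast
    rw [← hza]
    simp only [w]
    linear_combination (2 * Real.pi * z * ‖freq L m‖ * vol L * coeff L u m) * Complex.I_sq
  rw [h5, Complex.neg_re, neg_neg, Complex.ofReal_re]

/-- The cube of multi-indices `0 ≤ k i < M`. -/
def cube (n : ℕ) (M : ℕ) : Finset (Fin n → ℤ) := Fintype.piFinset fun _ => Finset.Ico (0 : ℤ) M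

theorem card_cube (M : ℕ) : (cube n M).card = M ^ n := by
  simp [cube]

/-- `K = |∑ e_k|² / (2N)^n`, with `k` running over the cube of side `2N`. As a square it is
nonnegative. Its coefficient at `m` is the proportion of `k` in the cube for which `k - m` also lies
in the cube, hence nonnegative, equal to `1` at `m = 0`, and at least `2^{-n}` when every `|m i| ≤
N`. -/
theorem exists_fejer_kernel (L : Fin n → ℝ) [∀ i, Fact (0 < L i)] {N : ℕ} (hN : 1 ≤ N) :
    ∃ (S : Finset (Fin n → ℤ)) (κ : (Fin n → ℤ) → ℝ) (K : FlatTorus L → ℝ),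
      IsTrig L S (fun m => κ m) K ∧ (∀ x, 0 ≤ K x) ∧ (∀ x, K x ≤ (2 * N : ℝ) ^ n) ∧
      ∫ x, K x = vol L ∧ (∀ m, 0 ≤ κ m) ∧
      (∀ m : Fin n → ℤ, (∀ i, |m i| ≤ (N : ℤ)) → m ∈ S ∧ (2 ^ n : ℝ)⁻¹ ≤ κ m) := by
  classical
  set Q := cube n (2 * N)
  have hQ : Q.card = (2 * N) ^ n := card_cube _
  have hQ0 : (0 : ℝ) < (2 * N : ℝ) ^ n := by positivity
  let g : (Fin n → ℤ) × (Fin n → ℤ) → (Fin n → ℤ) := fun p => p.1 - p.2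
  let S := (Q ×ˢ Q).image g
  let κ : (Fin n → ℤ) → ℝ := fun m => (((Q ×ˢ Q).filter fun p => g p = m).card : ℝ) / (2 * N : ℝ) ^ n
  let K : FlatTorus L → ℝ := fun x => ‖∑ k ∈ Q, char L k x‖ ^ 2 / (2 * N : ℝ) ^ n
  have hK : IsTrig L S (fun m => κ m) K := by
    intro x
    have h1 : ((‖∑ k ∈ Q, char L k x‖ ^ 2 : ℝ) : ℂ) = ∑ p ∈ Q ×ˢ Q, char L (g p) x := by
      rw [← Complex.normSq_eq_norm_sq, ← Complex.mul_conj, map_sum, Finset.sum_mul_sum,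
        Finset.sum_product]
      simp only [g, char_sub_index]
    simp only [K]
    rw [Complex.ofReal_div, h1, Finset.sum_comp (fun m => char L m x) g, Finset.sum_div]
    refine Finset.sum_congr rfl fun m _ => ?_
    simp only [κ, nsmul_eq_mul]
    push_cast
    ring
  have hκ : ∀ m, 0 ≤ κ m := fun m => by positivity
  have hκ' : ∀ m : Fin n → ℤ, (∀ i, |m i| ≤ (N : ℤ)) → (N : ℝ) ^ n ≤ (((Q ×ˢ Q).filter fun p => g p = m).card : ℝ) := by
    intro m hm
    have h1 : (cube n N).card ≤ ((Q ×ˢ Q).filter fun p => g p = m).card := by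
      -- Shifting `j` in the cube of side `N` by the positive and by the negative part of `m` gives
      -- `N^n` pairs with difference `m`; both entries stay below `2N` because `|m i| ≤ N`.
      refine Finset.card_le_card_of_injOn
        (fun j => ((fun i => j i + max (m i) 0), (fun i => j i + max (-m i) 0))) ?_ ?_
      · intro j hj
        simp only [cube, Finset.mem_coe, Fintype.mem_piFinset, Finset.mem_Ico] at hj
        simp only [Q, g, cube, Finset.coe_filter, Finset.mem_product, Fintype.mem_piFinset,
          Finset.mem_Ico, Set.mem_ofPred_eq]
        refine ⟨⟨fun i => ?_, fun i => ?_⟩, ?_⟩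
        · have := abs_le.1 (hm i); have := hj i
          push_cast
          omega
        · have := abs_le.1 (hm i); have := hj i
          push_cast
          omega
        · funext i
          simp only [Pi.sub_apply]
          omega
      · intro j _ j' _ h
        funext i
        have := congrFun (congrArg Prod.fst h) i
        simpa using this
    rw [card_cube] at h1
    exact_mod_cast h1
  have hκ0 : κ 0 = 1 := by
    have h1 : ((Q ×ˢ Q).filter fun p => g p = 0) = Q.diag := by
      ext ⟨a, b⟩
      simp only [g, Finset.mem_filter, Finset.mem_product, Finset.mem_diag, sub_eq_zero]
      constructor
      · rintro ⟨⟨h1, h2⟩, h3⟩; exact ⟨h1, h3⟩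
      · rintro ⟨h1, h3⟩; exact ⟨⟨h1, h3 ▸ h1⟩, h3⟩
    simp only [κ]
    rw [h1, Finset.diag_card, hQ]
    push_cast
    exact div_self hQ0.ne'
  have hS : ∀ m : Fin n → ℤ, (∀ i, |m i| ≤ (N : ℤ)) → m ∈ S := by
    intro m hm
    have h1 := hκ' m hm
    have h2 : 0 < ((Q ×ˢ Q).filter fun p => g p = m).card := by
      have : (0 : ℝ) < (N : ℝ) ^ n := by positivity
      exact_mod_cast this.trans_le h1
    obtain ⟨p, hp⟩ := Finset.card_pos.1 h2
    rw [Finset.mem_filter] at hp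
    exact Finset.mem_image.2 ⟨p, hp.1, hp.2⟩
  refine ⟨S, κ, K, hK, fun x => by positivity, fun x => ?_, ?_, hκ, fun m hm => ⟨hS m hm, ?_⟩⟩
  · simp only [K]
    rw [div_le_iff₀ hQ0, ← sq]
    have h1 : ‖∑ k ∈ Q, char L k x‖ ≤ (2 * N : ℝ) ^ n := by
      refine (norm_sum_le _ _).trans ?_
      simp [hQ]
    gcongr
  · have h1 := hK.integral_eq
    rw [if_pos (hS 0 (by simp)), hκ0] at h1
    simpa using h1
  · simp only [κ]
    rw [le_div_iff₀ hQ0, mul_pow, inv_mul_cancel_left₀ (by positivity)]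
    exact hκ' m hm

end

/-! ### Mollification, gradient bounds, and the dual norm at low frequencies. -/

section

variable {n : ℕ} {L : Fin n → ℝ} {u : FlatTorus L → ℝ}

variable (L) in
theorem continuous_grad_of_isTrig {S : Finset (Fin n → ℤ)} {c : (Fin n → ℤ) → ℂ}
    {f : FlatTorus L → ℝ} (h : IsTrig L S c f) : Continuous (grad L f) :=
  (PiLp.continuous_toLp 2 _).comp (continuous_pi fun i => (h.trig_pderiv i).continuous)

/-- The direction of the gradient. -/
def gradDir (L : Fin n → ℝ) (f : FlatTorus L → ℝ) (x : FlatTorus L) : EuclideanSpace ℝ (Fin n) :=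
  ‖grad L f x‖⁻¹ • grad L f x

theorem norm_gradDir_le (f : FlatTorus L → ℝ) (x : FlatTorus L) : ‖gradDir L f x‖ ≤ 1 := by
  rw [gradDir, norm_smul, norm_inv, norm_norm]
  exact inv_mul_le_one

theorem sum_pderiv_mul_gradDir (f : FlatTorus L → ℝ) (x : FlatTorus L) :
    ∑ i, pderiv L i f x * gradDir L f x i = ‖grad L f x‖ := by
  have h : ∑ i, (pderiv L i f x) ^ 2 = ‖grad L f x‖ ^ 2 := by
    rw [EuclideanSpace.norm_sq_eq]; simp [grad]
  have h1 : ∀ i, pderiv L i f x * gradDir L f x i = ‖grad L f x‖⁻¹ * (pderiv L i f x) ^ 2 := by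
    intro i
    simp only [gradDir, PiLp.smul_apply, smul_eq_mul, grad]
    ring
  simp only [h1, ← Finset.mul_sum, h]
  by_cases h0 : ‖grad L f x‖ = 0
  · simp [h0]
  · field_simp

theorem measurable_gradDir {S : Finset (Fin n → ℤ)} {c : (Fin n → ℤ) → ℂ}
    {f : FlatTorus L → ℝ} (h : IsTrig L S c f) : Measurable (gradDir L f) := by
  have := (continuous_grad_of_isTrig L h).measurable
  exact this.norm.inv.smul this

variable (L) in
theorem norm_freq_neg (m : Fin n → ℤ) : ‖freq L (-m)‖ = ‖freq L m‖ := by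
  have : freq L (-m) = -freq L m := by
    ext i
    simp [freq, neg_div]
  rw [this, norm_neg]

variable [∀ i, Fact (0 < L i)]

/-- Convolution of `u` with the kernel `K`, normalized by the volume of the torus. -/
def mollify (K u : FlatTorus L → ℝ) (x : FlatTorus L) : ℝ :=
  (vol L)⁻¹ * ∫ y, K (x - y) * u y

theorem IsTrig.trig_mollify (hu : Integrable u) {S : Finset (Fin n → ℤ)} {κ : (Fin n → ℤ) → ℝ}
    {K : FlatTorus L → ℝ} (hK : IsTrig L S (fun m => κ m) K) :
    IsTrig L S (fun m => κ m * coeff L u m) (mollify K u) := by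
  intro x
  have hV : (vol L : ℂ) ≠ 0 := by exact_mod_cast (vol_pos (L := L)).ne'
  have h1 : ∀ y, ((K (x - y) * u y : ℝ) : ℂ) =
      ∑ m ∈ S, (κ m * char L m x) * (char L (-m) y * (u y : ℂ)) := by
    intro y
    rw [Complex.ofReal_mul, hK, Finset.sum_mul]
    refine Finset.sum_congr rfl fun m _ => ?_
    rw [sub_eq_add_neg, char_add, char_neg]
    ring
  rw [FlatTorus.mollify, Complex.ofReal_mul, ← integral_complex_ofReal]
  simp only [h1]
  rw [integral_finsetSum _ fun m _ => (integrable_char_mul hu _).const_mul _]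
  simp only [integral_const_mul, integral_char_mul_eq, neg_neg]
  rw [Finset.mul_sum]
  refine Finset.sum_congr rfl fun m _ => ?_
  push_cast
  field_simp

/-- The gradient of a mollified function of bounded variation, tested against a bounded field with
respect to an arbitrary finite measure. -/
theorem integral_grad_mollify_le (hu : MemBV L u) {S : Finset (Fin n → ℤ)} {κ : (Fin n → ℤ) → ℝ}
    {K : FlatTorus L → ℝ} (hK : IsTrig L S (fun m => κ m) K) (hK0 : ∀ x, 0 ≤ K x)
    (ν : Measure (FlatTorus L)) [IsFiniteMeasure ν] {B : ℝ}
    (hB : ∀ y, ∫ x, K (x - y) ∂ν ≤ B * vol L)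
    {Ψ : FlatTorus L → EuclideanSpace ℝ (Fin n)} (hΨ : AEStronglyMeasurable Ψ ν)
    (hΨ1 : ∀ x, ‖Ψ x‖ ≤ 1) :
    ∫ x, ∑ i, pderiv L i (mollify K u) x * Ψ x i ∂ν ≤ B * tv L u := by
  have hV : (vol L : ℂ) ≠ 0 := by exact_mod_cast (vol_pos (L := L)).ne'
  have hΨi : ∀ i, Integrable (fun x => Ψ x i) ν := by
    intro i
    refine Integrable.of_bound (C := 1) ?_ ?_
    · exact (EuclideanSpace.proj (𝕜 := ℝ) i).continuous.comp_aestronglyMeasurable hΨ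
    · exact Filter.Eventually.of_forall fun x => (PiLp.norm_apply_le (Ψ x) i).trans (hΨ1 x)
  have hint : ∀ m i, Integrable (fun x => char L m x * (Ψ x i : ℂ)) ν := by
    intro m i
    refine (hΨi i).ofReal.bdd_mul (c := 1) (continuous_char L m).aestronglyMeasurable ?_
    exact Filter.Eventually.of_forall fun x => by simp
  let J : Fin n → (Fin n → ℤ) → ℂ := fun i m => ∫ x, char L (-m) x * (Ψ x i : ℂ) ∂ν
  have hKc : ∀ y, Continuous fun x => K (x - y) := fun y =>
    hK.continuous.comp (continuous_sub_right y)
  have hKΨ : ∀ y, Integrable (fun x => K (x - y) • Ψ x) ν := fun y =>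
    (integrable_of_continuous ν (hKc y)).smul_bdd 1 hΨ (Filter.Eventually.of_forall hΨ1)
  -- The adjoint of mollification applied to `Ψ dν`. It is a trigonometric polynomial, hence an
  -- admissible smooth field even though `Ψ` is merely measurable and `ν` may be singular.
  let Φ : FlatTorus L → EuclideanSpace ℝ (Fin n) := fun y =>
    (vol L)⁻¹ • ∫ x, K (x - y) • Ψ x ∂ν
  have hΦ : ∀ i, IsReTrig L S (fun m => (vol L : ℂ)⁻¹ * (κ m * J i m)) (fun y => Φ y i) := by
    intro i y
    have h1 : Φ y i = (vol L)⁻¹ * ∫ x, K (x - y) * Ψ x i ∂ν := by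
      have := (EuclideanSpace.proj (𝕜 := ℝ) i).integral_comp_comm (hKΨ y)
      simp only [Φ, PiLp.smul_apply, smul_eq_mul]
      congr 1
      exact this.symm
    have h2 : ∀ x, ((K (x - y) * Ψ x i : ℝ) : ℂ) =
        ∑ m ∈ S, (κ m * char L m y) * (char L (-m) x * (Ψ x i : ℂ)) := by
      intro x
      have h3 : ((K (x - y) : ℝ) : ℂ) = ∑ m ∈ S, κ m * char L m y * char L (-m) x := by
        rw [← Complex.conj_ofReal, hK, map_sum]
        refine Finset.sum_congr rfl fun m _ => ?_
        rw [sub_eq_add_neg, char_add, char_neg, map_mul, map_mul, Complex.conj_ofReal,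
          ← char_neg_index, ← char_neg_index, neg_neg]
        ring
      rw [Complex.ofReal_mul, h3, Finset.sum_mul]
      refine Finset.sum_congr rfl fun m _ => by ring
    have h4 : ((Φ y i : ℝ) : ℂ) = ∑ m ∈ S, ((vol L : ℂ)⁻¹ * (κ m * J i m)) * char L m y := by
      rw [h1, Complex.ofReal_mul, ← integral_complex_ofReal]
      simp only [h2]
      rw [integral_finsetSum _ fun m _ => (hint _ i).const_mul _, Finset.mul_sum]
      refine Finset.sum_congr rfl fun m _ => ?_
      rw [integral_const_mul]
      push_cast
      ring
    show Φ y i = _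
    rw [← h4, Complex.ofReal_re]
  have hΦB : ∀ y, ‖Φ y‖ ≤ B := by
    intro y
    simp only [Φ]
    rw [norm_smul, norm_inv, Real.norm_of_nonneg vol_pos.le, inv_mul_le_iff₀ vol_pos, mul_comm]
    refine le_trans ?_ (hB y)
    refine norm_integral_le_of_norm_le (integrable_of_continuous ν (hKc y)) ?_
    refine Filter.Eventually.of_forall fun x => ?_
    rw [norm_smul, Real.norm_of_nonneg (hK0 _)]
    exact mul_le_of_le_one_right (hK0 _) (hΨ1 x)
  have h1 := neg_integral_divergence_le hu (isCk_of_isReTrig hΦ _) hΦB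
  refine le_trans (le_of_eq ?_) h1
  rw [integral_mul_divergence hu.1 hΦ]
  have h2 : ∀ i, ∀ x, pderiv L i (mollify K u) x * Ψ x i =
      (∑ m ∈ S, -(dmult L i m * (κ m * coeff L u (-m))) * (char L (-m) x * (Ψ x i : ℂ))).re := by
    intro i x
    have h3 : ((pderiv L i (mollify K u) x : ℝ) : ℂ) =
        ∑ m ∈ S, -(dmult L i m * (κ m * coeff L u (-m))) * char L (-m) x := by
      rw [← Complex.conj_ofReal, (hK.trig_mollify hu.1).trig_pderiv i x, map_sum]
      refine Finset.sum_congr rfl fun m _ => ?_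
      rw [map_mul, map_mul, map_mul, Complex.conj_ofReal, conj_dmult, ← char_neg_index, ← coeff_neg]
      ring
    rw [← Complex.ofReal_re (pderiv L i (mollify K u) x * Ψ x i), Complex.ofReal_mul, h3,
      Finset.sum_mul]
    simp only [mul_assoc]
  have hint2 : ∀ i m, Integrable (fun x => -(dmult L i m * (κ m * coeff L u (-m))) *
      (char L (-m) x * (Ψ x i : ℂ))) ν := fun i m => (hint _ i).const_mul _
  simp only [h2, ← Complex.re_sum]
  have h3 := Complex.reCLM.integral_comp_comm
    (integrable_finsetSum Finset.univ fun i _ => integrable_finsetSum S fun m _ => hint2 i m)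
  simp only [Complex.reCLM_apply] at h3
  rw [h3, integral_finsetSum _ fun i _ => integrable_finsetSum S fun m _ => hint2 i m]
  simp only [integral_finsetSum _ fun m _ => hint2 _ m, integral_const_mul]
  rw [← Complex.neg_re]
  congr 1
  rw [Finset.sum_comm, ← Finset.sum_neg_distrib]
  refine Finset.sum_congr rfl fun m _ => ?_
  rw [Finset.sum_mul, ← Finset.sum_neg_distrib]
  refine Finset.sum_congr rfl fun i _ => ?_
  simp only [J]
  field_simp

/-- The case `ν = δ_x` of `integral_grad_mollify_le`, tested against the direction of the gradient.
-/
theorem norm_grad_mollify_le (hu : MemBV L u) {S : Finset (Fin n → ℤ)} {κ : (Fin n → ℤ) → ℝ}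
    {K : FlatTorus L → ℝ} (hK : IsTrig L S (fun m => κ m) K) (hK0 : ∀ x, 0 ≤ K x) {A : ℝ}
    (hA : ∀ x, K x ≤ A) (x : FlatTorus L) : ‖grad L (mollify K u) x‖ ≤ A / vol L * tv L u := by
  have h := integral_grad_mollify_le hu hK hK0 (Measure.dirac x) (B := A / vol L) ?_
    (Ψ := gradDir L (mollify K u)) (measurable_gradDir (hK.trig_mollify hu.1)).aestronglyMeasurable
    (norm_gradDir_le _)
  · simpa only [integral_dirac, sum_pderiv_mul_gradDir] using h
  · intro y
    rw [integral_dirac, div_mul_cancel₀ _ vol_pos.ne']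
    exact hA _

/-- The case where `ν` is Lebesgue measure: the normalization of `K` makes the adjoint field no
longer than `1`. -/
theorem integral_norm_grad_mollify_le (hu : MemBV L u) {S : Finset (Fin n → ℤ)}
    {κ : (Fin n → ℤ) → ℝ} {K : FlatTorus L → ℝ} (hK : IsTrig L S (fun m => κ m) K)
    (hK0 : ∀ x, 0 ≤ K x) (hK1 : ∫ x, K x = vol L) :
    ∫ x, ‖grad L (mollify K u) x‖ ≤ tv L u := by
  have h := integral_grad_mollify_le hu hK hK0 volume (B := 1) ?_
    (Ψ := gradDir L (mollify K u)) (measurable_gradDir (hK.trig_mollify hu.1)).aestronglyMeasurable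
    (norm_gradDir_le _)
  · simpa only [sum_pderiv_mul_gradDir, one_mul] using h
  · intro y
    rw [one_mul, ← hK1]
    exact (integral_sub_right_eq_self K y).le

/-- Interpolation between `L^∞` and `L¹`, from `|f|^{p'} ≤ D^{p'-1} |f|`; the exponents are `1/p`
and `1 - 1/p`. The endpoint `p = 1`, where `p' = ∞`, is treated apart. -/
theorem eLpNorm_conjExponent_le {α E : Type*} [MeasurableSpace α] {μ : Measure α}
    [NormedAddCommGroup E] {f : α → E} {D : ℝ} (hD : ∀ x, ‖f x‖ ≤ D) {p : ℝ≥0∞} (hp : 1 ≤ p) :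
    eLpNorm f p.conjExponent μ ≤
      ENNReal.ofReal D ^ (p⁻¹).toReal * (∫⁻ x, ‖f x‖ₑ ∂μ) ^ (1 - (p⁻¹).toReal) := by
  have hc : ENNReal.HolderConjugate p p.conjExponent := .conjExponent hp
  have hDe : ∀ x, ‖f x‖ₑ ≤ ENNReal.ofReal D := fun x => by
    rw [← ofReal_norm]; exact ENNReal.ofReal_le_ofReal (hD x)
  by_cases hq : p.conjExponent = ∞
  · have hp1 : p = 1 := by
      have := hc.inv_add_inv_eq_one
      rw [hq] at this
      simpa using this
    rw [hq, hp1, eLpNorm_exponent_top]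
    simpa using eLpNormEssSup_le_of_ae_enorm_bound (Filter.Eventually.of_forall hDe)
  · have hq0 : p.conjExponent ≠ 0 := by
      simp [ENNReal.conjExponent]
    have hq1 : 1 ≤ p.conjExponent.toReal := by
      rw [← ENNReal.toReal_one]
      exact ENNReal.toReal_mono hq (by simp [ENNReal.conjExponent])
    have hinv : 1 - (p⁻¹).toReal = 1 / p.conjExponent.toReal := by
      have h1 := congrArg ENNReal.toReal hc.inv_add_inv_eq_one
      rw [ENNReal.toReal_add (by simp; rintro rfl; simp at hp) (by simpa using hq0), ENNReal.toReal_one,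
        ENNReal.toReal_inv p.conjExponent] at h1
      rw [one_div]
      linarith
    rw [eLpNorm_eq_lintegral_rpow_enorm_toReal hq0 hq]
    set t := p.conjExponent.toReal
    have ht : 0 < t := by linarith
    have h1 : ∫⁻ x, ‖f x‖ₑ ^ t ∂μ ≤ ENNReal.ofReal D ^ (t - 1) * ∫⁻ x, ‖f x‖ₑ ∂μ := by
      rw [← lintegral_const_mul' _ _ (by finiteness)]
      refine lintegral_mono fun x => ?_
      calc ‖f x‖ₑ ^ t = ‖f x‖ₑ ^ (t - 1) * ‖f x‖ₑ := by
            have := ENNReal.rpow_add_of_nonneg (x := ‖f x‖ₑ) (t - 1) 1 (by linarith) zero_le_one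
            simpa using this
        _ ≤ ENNReal.ofReal D ^ (t - 1) * ‖f x‖ₑ := by
            gcongr
            exact hDe x
    calc (∫⁻ x, ‖f x‖ₑ ^ t ∂μ) ^ (1 / t)
        ≤ (ENNReal.ofReal D ^ (t - 1) * ∫⁻ x, ‖f x‖ₑ ∂μ) ^ (1 / t) := by gcongr
      _ = _ := by
        rw [ENNReal.mul_rpow_of_nonneg _ _ (by positivity), ← ENNReal.rpow_mul, hinv]
        congr 2
        have : (p⁻¹).toReal = 1 - 1 / t := by linarith
        rw [this]
        field_simp

theorem eLpNorm_grad_mollify_le (hu : MemBV L u) {S : Finset (Fin n → ℤ)}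
    {κ : (Fin n → ℤ) → ℝ} {K : FlatTorus L → ℝ} (hK : IsTrig L S (fun m => κ m) K)
    (hK0 : ∀ x, 0 ≤ K x) (hK1 : ∫ x, K x = vol L) {A : ℝ} (hA0 : 0 ≤ A) (hA : ∀ x, K x ≤ A)
    {p : ℝ≥0∞} (hp : 1 ≤ p) :
    eLpNorm (grad L (mollify K u)) p.conjExponent volume ≤
      ENNReal.ofReal (tv L u * (A / vol L) ^ (p⁻¹).toReal) := by
  have hα : (p⁻¹).toReal ≤ 1 := by
    rw [← ENNReal.toReal_one]
    exact ENNReal.toReal_mono ENNReal.one_ne_top (ENNReal.inv_le_one.2 hp)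
  refine (eLpNorm_conjExponent_le (norm_grad_mollify_le hu hK hK0 hA) hp).trans ?_
  have hV := vol_pos (L := L)
  have hT := tv_nonneg (u := u)
  have h1 : ∫⁻ x, ‖grad L (mollify K u) x‖ₑ ≤ ENNReal.ofReal (tv L u) := by
    have h2 : Integrable (grad L (mollify K u)) :=
      integrable_of_continuous _ (continuous_grad_of_isTrig L (hK.trig_mollify hu.1))
    rw [← ofReal_integral_norm_eq_lintegral_enorm h2]
    exact ENNReal.ofReal_le_ofReal (integral_norm_grad_mollify_le hu hK hK0 hK1)
  have hα0 : 0 ≤ 1 - (p⁻¹).toReal := by linarith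
  calc ENNReal.ofReal (A / vol L * tv L u) ^ (p⁻¹).toReal *
        (∫⁻ x, ‖grad L (mollify K u) x‖ₑ) ^ (1 - (p⁻¹).toReal)
      ≤ ENNReal.ofReal (A / vol L * tv L u) ^ (p⁻¹).toReal *
        ENNReal.ofReal (tv L u) ^ (1 - (p⁻¹).toReal) := by gcongr
    _ = _ := by
      rw [ENNReal.ofReal_rpow_of_nonneg (by positivity) ENNReal.toReal_nonneg,
        ENNReal.ofReal_rpow_of_nonneg hT hα0, ← ENNReal.ofReal_mul (by positivity)]
      congr 1
      rw [Real.mul_rpow (by positivity) hT, mul_assoc, ← Real.rpow_add' hT (by simp),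
        add_sub_cancel, Real.rpow_one, mul_comm]

/-- Homogeneity of the dual norm. As `D` may be zero, the test function is normalized by any `E >
D`, and then `E` decreases to `D`. -/
theorem pairing_le (b : (Fin n → ℤ) → ℂ) {p : ℝ≥0∞} (hW : wdotNegNorm L p b ≠ ∞)
    {φ : FlatTorus L → ℝ} (hφ : IsCk L 1 φ) (hφ0 : ∫ x, φ x = 0) {D : ℝ} (hD : 0 ≤ D)
    (hφD : eLpNorm (grad L φ) p.conjExponent volume ≤ ENNReal.ofReal D) :
    (pairing L b φ).re ≤ D * (wdotNegNorm L p b).toReal := by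
  have key : ∀ E : ℝ, D < E → (pairing L b φ).re ≤ E * (wdotNegNorm L p b).toReal := by
    intro E hE
    have hE0 : 0 < E := hD.trans_lt hE
    have hg : grad L (fun x => E⁻¹ * φ x) = E⁻¹ • grad L φ := by
      funext x
      ext i
      simp [grad, pderiv, deriv_const_mul_field]
    have h1 : ENNReal.ofReal (pairing L b (fun x => E⁻¹ * φ x)).re ≤ wdotNegNorm L p b := by
      unfold wdotNegNorm
      refine le_iSup_of_le (fun x => E⁻¹ * φ x) (le_iSup_of_le ?_ (le_iSup_of_le ?_
        (le_iSup_of_le ?_ le_rfl)))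
      · exact ContDiff.const_smul E⁻¹ hφ
      · rw [integral_const_mul, hφ0, mul_zero]
      · rw [hg, eLpNorm_const_smul]
        calc ‖E⁻¹‖ₑ * eLpNorm (grad L φ) p.conjExponent volume
            ≤ ENNReal.ofReal E⁻¹ * ENNReal.ofReal E := by
              gcongr
              · rw [Real.enorm_of_nonneg (by positivity)]
              · exact hφD.trans (ENNReal.ofReal_le_ofReal hE.le)
          _ = 1 := by
              rw [← ENNReal.ofReal_mul (by positivity), inv_mul_cancel₀ hE0.ne', ENNReal.ofReal_one]
    have h2 : pairing L b (fun x => E⁻¹ * φ x) = ((E⁻¹ : ℝ) : ℂ) * pairing L b φ := by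
      unfold pairing
      rw [← tsum_mul_left]
      refine tsum_congr fun m => ?_
      have h3 : ∀ x, char L m x * ((E⁻¹ * φ x : ℝ) : ℂ) =
          ((E⁻¹ : ℝ) : ℂ) * (char L m x * (φ x : ℂ)) := by
        intro x
        push_cast
        ring
      simp only [h3, integral_const_mul]
      ring
    have h3 := (ENNReal.ofReal_le_iff_le_toReal hW).1 h1
    rw [h2, Complex.re_ofReal_mul, inv_mul_le_iff₀ hE0] at h3
    exact h3
  refine le_of_forall_pos_le_add fun ε hε => ?_
  set W := (wdotNegNorm L p b).toReal
  have hW0 : 0 ≤ W := ENNReal.toReal_nonneg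
  have h4 : 0 < ε / (W + 1) := by positivity
  refine (key (D + ε / (W + 1)) (by linarith)).trans ?_
  rw [add_mul]
  gcongr
  rw [div_mul_eq_mul_div, div_le_iff₀ (by positivity)]
  nlinarith

theorem pairing_of_isTrig (b : (Fin n → ℤ) → ℂ) {S : Finset (Fin n → ℤ)} {c : (Fin n → ℤ) → ℂ}
    {φ : FlatTorus L → ℝ} (h : IsTrig L S c φ) :
    pairing L b φ = ∑ m ∈ S, b (-m) * (vol L * c m) := by
  unfold pairing
  simp only [h.integral_char_mul]
  rw [← (Equiv.neg (Fin n → ℤ)).tsum_eq, tsum_eq_sum (s := S)]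
  · refine Finset.sum_congr rfl fun m hm => ?_
    simp [hm]
  · intro m hm
    simp [hm]

/-- Low frequencies are controlled by the duality pairing with a mollification of `u`. -/
theorem sum_low_le (hu : MemBV L u) (hu0 : coeff L u 0 = 0) {s : ℝ} {p : ℝ≥0∞} (hp : 1 ≤ p)
    (hW : wdotNegNorm L p (fracLaplacian L (-s) (coeff L u)) ≠ ∞) {N : ℕ} (hN : 1 ≤ N)
    {F : Finset (Fin n → ℤ)} (hF : ∀ m ∈ F, m ≠ 0 ∧ ∀ i, |m i| ≤ (N : ℤ)) :
    vol L * ∑ m ∈ F, (2 * Real.pi * ‖freq L m‖) ^ (2 * -s) * ‖coeff L u m‖ ^ 2 ≤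
      2 ^ n * (tv L u * ((2 * N : ℝ) ^ n / vol L) ^ (p⁻¹).toReal *
        (wdotNegNorm L p (fracLaplacian L (-s) (coeff L u))).toReal) := by
  obtain ⟨S, κ, K, hK, hK0, hKA, hK1, hκ0, hκ⟩ := exists_fejer_kernel L hN
  have hV := vol_pos (L := L)
  have hT := tv_nonneg (u := u)
  have hφ := hK.trig_mollify hu.1
  have hφ0 : ∫ x, mollify K u x = 0 := by
    have := hφ.integral_eq
    rw [hu0] at this
    simpa using this
  have h1 := pairing_le (fracLaplacian L (-s) (coeff L u)) hW (hφ.isReTrig.isCk 1) hφ0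
    (by positivity) (eLpNorm_grad_mollify_le hu hK hK0 hK1 (by positivity) hKA hp)
  rw [pairing_of_isTrig _ hφ] at h1
  set g : (Fin n → ℤ) → ℝ := fun m => (2 * Real.pi * ‖freq L m‖) ^ (2 * -s) * ‖coeff L u m‖ ^ 2
  have hg : ∀ m, 0 ≤ g m := fun m => by positivity
  have h2 : ∀ m, m ≠ 0 → (fracLaplacian L (-s) (coeff L u) (-m) *
      (vol L * (κ m * coeff L u m))).re = vol L * (κ m * g m) := by
    intro m hm
    rw [fracLaplacian, if_neg (by simpa using hm), coeff_neg, norm_freq_neg]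
    have h3 : starRingEnd ℂ (coeff L u m) * coeff L u m = ((‖coeff L u m‖ ^ 2 : ℝ) : ℂ) := by
      rw [mul_comm, Complex.mul_conj, Complex.normSq_eq_norm_sq]
    have h4 : (((2 * Real.pi * ‖freq L m‖) ^ (2 * -s) : ℝ) : ℂ) * starRingEnd ℂ (coeff L u m) *
        (vol L * (κ m * coeff L u m)) = ((vol L * (κ m * g m) : ℝ) : ℂ) := by
      simp only [g]
      rw [Complex.ofReal_mul, Complex.ofReal_mul, Complex.ofReal_mul, ← h3]
      ring
    rw [h4, Complex.ofReal_re]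
  -- Every frequency contributes a nonnegative amount `κ m * g m` to the pairing, so those outside
  -- `F` can be dropped; on `F` the coefficient `κ m` is at least `2^{-n}`.
  have h5 : vol L * ∑ m ∈ F, (2 ^ n : ℝ)⁻¹ * g m ≤ (∑ m ∈ S, fracLaplacian L (-s) (coeff L u) (-m) *
      (vol L * (κ m * coeff L u m))).re := by
    rw [Complex.re_sum, Finset.mul_sum]
    calc ∑ m ∈ F, vol L * ((2 ^ n : ℝ)⁻¹ * g m)
        ≤ ∑ m ∈ F, (fracLaplacian L (-s) (coeff L u) (-m) *
          (vol L * (κ m * coeff L u m))).re := by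
          refine Finset.sum_le_sum fun m hm => ?_
          rw [h2 m (hF m hm).1]
          gcongr
          exact (hκ m (hF m hm).2).2
      _ ≤ _ := by
          refine Finset.sum_le_sum_of_subset_of_nonneg
            (fun m hm => (hκ m (hF m hm).2).1) fun m _ _ => ?_
          by_cases hm : m = 0
          · simp [hm, hu0]
          · rw [h2 m hm]
            exact mul_nonneg hV.le (mul_nonneg (hκ0 m) (hg m))
  rw [← Finset.mul_sum, mul_left_comm, inv_mul_le_iff₀ (by positivity)] at h5
  refine h5.trans ?_
  gcongr

end

/-! ### Poincaré and Gagliardo–Nirenberg inequalities on the torus. -/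

section

variable {n : ℕ} {L : Fin n → ℝ}
  {S : Finset (Fin n → ℤ)} {c : (Fin n → ℤ) → ℂ} {f : FlatTorus L → ℝ}

theorem continuous_single (i : Fin n) :
    Continuous fun t : AddCircle (L i) => (Pi.single i t : FlatTorus L) :=
  _root_.continuous_single (A := fun j => AddCircle (L j)) i

theorem enorm_pderiv_le (i : Fin n) (x : FlatTorus L) :
    ‖pderiv L i f x‖ₑ ≤ ‖grad L f x‖ₑ :=
  enorm_le_iff_norm_le.2 (PiLp.norm_apply_le (grad L f x) i)

variable [∀ i, Fact (0 < L i)]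

/-- The fundamental theorem of calculus along a coordinate circle: represent `t` in one period and
enlarge the arc to the whole circle. -/
theorem IsTrig.enorm_sub_le (h : IsTrig L S c f) (x : FlatTorus L) (i : Fin n)
    (t : AddCircle (L i)) :
    ‖f (x + (Pi.single i t : FlatTorus L)) - f x‖ₑ ≤ ∫⁻ τ, ‖pderiv L i f (x + (Pi.single i τ : FlatTorus L))‖ₑ := by
  have hL := period_pos (L := L) i
  have hc : Continuous fun τ : AddCircle (L i) => pderiv L i f (x + (Pi.single i τ : FlatTorus L)) :=
    (h.trig_pderiv i).continuous.comp (continuous_const.add (continuous_single i))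
  obtain ⟨t, ht0, htL, rfl⟩ : ∃ t' : ℝ, 0 ≤ t' ∧ t' ≤ L i ∧ (t' : AddCircle (L i)) = t := by
    have h1 := (AddCircle.equivIco (L i) 0 t).2
    refine ⟨(AddCircle.equivIco (L i) 0 t : ℝ), h1.1, ?_, AddCircle.coe_equivIco⟩
    simpa using h1.2.le
  have hcr : Continuous fun τ : ℝ => pderiv L i f (x + (Pi.single i (τ : AddCircle (L i)) : FlatTorus L)) :=
    hc.comp (AddCircle.continuous_mk' _)
  have h1 := intervalIntegral.integral_eq_sub_of_hasDerivAt (a := 0) (b := t)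
    (fun τ _ => h.isReTrig.hasDerivAt i x τ) (hcr.intervalIntegrable _ _)
  rw [AddCircle.coe_zero, Pi.single_zero, add_zero] at h1
  rw [← h1]
  have h2 : ‖∫ τ in 0..t, pderiv L i f (x + (Pi.single i (τ : AddCircle (L i)) : FlatTorus L))‖ ≤
      ∫ τ in 0..L i, ‖pderiv L i f (x + (Pi.single i (τ : AddCircle (L i)) : FlatTorus L))‖ := by
    refine (intervalIntegral.norm_integral_le_integral_norm ht0).trans ?_
    refine intervalIntegral.integral_mono_interval le_rfl ht0 htL
      (Filter.Eventually.of_forall fun τ => norm_nonneg _) (hcr.norm.intervalIntegrable _ _)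
  have h3 := AddCircle.intervalIntegral_preimage (L i) 0
    (fun τ => ‖pderiv L i f (x + (Pi.single i τ : FlatTorus L))‖)
  rw [zero_add] at h3
  have hint : Integrable fun τ : AddCircle (L i) => pderiv L i f (x + (Pi.single i τ : FlatTorus L)) := by
    rw [← integrableOn_univ]
    exact hc.continuousOn.integrableOn_compact isCompact_univ
  rw [← ofReal_integral_norm_eq_lintegral_enorm hint, ← ofReal_norm]
  exact ENNReal.ofReal_le_ofReal (h2.trans h3.le)

theorem IsTrig.lintegral_enorm_sub_le (h : IsTrig L S c f) (i : Fin n) (t : AddCircle (L i)) :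
    ∫⁻ x, ‖f (x + (Pi.single i t : FlatTorus L)) - f x‖ₑ ≤ ENNReal.ofReal (L i) * ∫⁻ x, ‖pderiv L i f x‖ₑ := by
  refine (lintegral_mono fun x => h.enorm_sub_le x i t).trans ?_
  rw [lintegral_lintegral_swap]
  · have h1 : ∀ τ : AddCircle (L i), ∫⁻ x : FlatTorus L, ‖pderiv L i f (x + (Pi.single i τ : FlatTorus L))‖ₑ =
        ∫⁻ x, ‖pderiv L i f x‖ₑ := fun τ =>
      lintegral_add_right_eq_self (fun x => ‖pderiv L i f x‖ₑ) _
    simp only [h1, lintegral_const, AddCircle.measure_univ]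
    rw [mul_comm]
  · refine Continuous.aemeasurable ?_
    have h1 : Continuous fun z : FlatTorus L × AddCircle (L i) => z.1 + (Pi.single i z.2 : FlatTorus L) :=
      continuous_fst.add ((continuous_single i).comp continuous_snd)
    exact ((h.trig_pderiv i).continuous.comp h1).enorm

theorem IsTrig.lintegral_enorm_sub_sum_le (h : IsTrig L S c f) (y : FlatTorus L)
    (s : Finset (Fin n)) :
    ∫⁻ x, ‖f (x + ∑ i ∈ s, (Pi.single i (y i) : FlatTorus L)) - f x‖ₑ ≤
      ∑ i ∈ s, ENNReal.ofReal (L i) * ∫⁻ x, ‖pderiv L i f x‖ₑ := by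
  induction s using Finset.induction_on with
  | empty => simp
  | insert j s hj ih =>
    set z : FlatTorus L := ∑ i ∈ s, (Pi.single i (y i) : FlatTorus L)
    have hm : Measurable fun x : FlatTorus L => ‖f (x + z + (Pi.single j (y j) : FlatTorus L)) - f (x + z)‖ₑ :=
      (((h.continuous.comp ((continuous_add_const z).add continuous_const)).sub
        (h.continuous.comp (continuous_add_const z))).enorm).measurable
    calc ∫⁻ x : FlatTorus L, ‖f (x + ∑ i ∈ insert j s, (Pi.single i (y i) : FlatTorus L)) - f x‖ₑ
        ≤ ∫⁻ x : FlatTorus L, (‖f (x + z + (Pi.single j (y j) : FlatTorus L)) - f (x + z)‖ₑ + ‖f (x + z) - f x‖ₑ) := by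
          refine lintegral_mono fun x => ?_
          rw [Finset.sum_insert hj, add_comm ((Pi.single j (y j) : FlatTorus L)), ← add_assoc]
          have h1 := enorm_add_le (f (x + z + (Pi.single j (y j) : FlatTorus L)) - f (x + z)) (f (x + z) - f x)
          rwa [sub_add_sub_cancel] at h1
      _ = (∫⁻ x : FlatTorus L, ‖f (x + z + (Pi.single j (y j) : FlatTorus L)) - f (x + z)‖ₑ) +
            ∫⁻ x : FlatTorus L, ‖f (x + z) - f x‖ₑ :=
          lintegral_add_left hm _
      _ ≤ _ := by
          rw [Finset.sum_insert hj, lintegral_add_right_eq_self (fun x => ‖f (x + (Pi.single j (y j) : FlatTorus L)) - f x‖ₑ) z]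
          exact add_le_add (h.lintegral_enorm_sub_le j (y j)) ih

/-- The `L¹` Poincaré inequality for average-free trigonometric polynomials. -/
theorem IsTrig.lintegral_enorm_le (h : IsTrig L S c f) (h0 : ∫ x, f x = 0) :
    ∫⁻ x, ‖f x‖ₑ ≤ ∑ i, ENNReal.ofReal (L i) * ∫⁻ x, ‖pderiv L i f x‖ₑ := by
  have hV := vol_pos (L := L)
  have hVe : ENNReal.ofReal (vol L) ≠ 0 := by simpa using hV
  have h1 : ∀ x, ENNReal.ofReal (vol L) * ‖f x‖ₑ ≤ ∫⁻ y, ‖f (x + y) - f x‖ₑ := by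
    intro x
    have hi : Integrable fun y => f (x + y) :=
      integrable_of_continuous _ (h.continuous.comp (continuous_const_add x))
    -- As the mean of `f` vanishes, `f x` is minus the average of its increments; these are
    -- controlled one coordinate at a time.
    have h2 : ∫ y, (f (x + y) - f x) = -(vol L * f x) := by
      rw [integral_sub hi (integrable_const _), integral_add_left_eq_self f x, h0, integral_const,
        volume_real_univ]
      simp
    calc ENNReal.ofReal (vol L) * ‖f x‖ₑ = ‖∫ y, (f (x + y) - f x)‖ₑ := by
          rw [h2, enorm_neg, enorm_mul, Real.enorm_of_nonneg hV.le]
      _ ≤ _ := enorm_integral_le_lintegral_enorm _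
  have h3 : ENNReal.ofReal (vol L) * ∫⁻ x, ‖f x‖ₑ ≤
      ENNReal.ofReal (vol L) * ∑ i, ENNReal.ofReal (L i) * ∫⁻ x, ‖pderiv L i f x‖ₑ := by
    rw [← lintegral_const_mul' _ _ (by finiteness)]
    refine (lintegral_mono h1).trans ?_
    rw [lintegral_lintegral_swap]
    · calc ∫⁻ y, ∫⁻ x, ‖f (x + y) - f x‖ₑ
          ≤ ∫⁻ _ : FlatTorus L, ∑ i, ENNReal.ofReal (L i) * ∫⁻ x, ‖pderiv L i f x‖ₑ := by
            refine lintegral_mono fun y => ?_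
            have := h.lintegral_enorm_sub_sum_le y Finset.univ
            rwa [Finset.univ_sum_single] at this
        _ = _ := by
            rw [lintegral_const, volume_univ, mul_comm]
    · refine Continuous.aemeasurable ?_
      exact ((h.continuous.comp (continuous_fst.add continuous_snd)).sub
        (h.continuous.comp continuous_fst)).enorm
  exact (ENNReal.mul_le_mul_iff_right hVe (by finiteness)).1 h3

/-- The Gagliardo–Nirenberg inequality for average-free trigonometric polynomials. -/
theorem IsTrig.lintegral_rpow_le (h : IsTrig L S c f) (h0 : ∫ x, f x = 0) {q : ℝ}
    (hq : Real.HolderConjugate n q) {ℓ Λ : ℝ} (hℓ : 0 < ℓ) (hℓL : ∀ i, ℓ ≤ L i)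
    (hLΛ : ∀ i, L i ≤ Λ * ℓ) :
    ∫⁻ x, ‖f x‖ₑ ^ q ≤ (ENNReal.ofReal (n * Λ + 1) * ∫⁻ x, ‖grad L f x‖ₑ) ^ q := by
  classical
  have hn1 : (1 : ℝ) < n := hq.lt
  have hn0 : 0 < n := by
    by_contra h
    have : n = 0 := by omega
    subst this
    norm_num at hn1
  have hΛ : 0 ≤ Λ := by
    have h1 := (hℓL ⟨0, hn0⟩).trans (hLΛ ⟨0, hn0⟩)
    by_contra h2
    nlinarith
  -- On a circle there is no point at infinity where `f` vanishes. The value `f x` is instead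
  -- compared with the average of `|f|` over the circle, which costs the zeroth-order term `|f| /
  -- ℓ`; the Poincaré inequality `hP` absorbs it at the end.
  let G : FlatTorus L → ℝ≥0∞ := fun x => ENNReal.ofReal ℓ⁻¹ * ‖f x‖ₑ + ‖grad L f x‖ₑ
  have hfm : Measurable fun x => ENNReal.ofReal ℓ⁻¹ * ‖f x‖ₑ :=
    h.continuous.enorm.measurable.const_mul _
  have hGm : Measurable G := hfm.add (continuous_grad_of_isTrig L h).enorm.measurable
  have hup : ∀ (x : FlatTorus L) (i : Fin n) (t : AddCircle (L i)),
      x + (Pi.single i t : FlatTorus L) = Function.update x i (x i + t) := by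
    intro x i t
    funext j
    by_cases hj : j = i
    · subst hj; simp
    · simp [hj]
  have hG : ∀ x i, ‖f x‖ₑ ≤ ∫⁻ t, G (Function.update x i t) := by
    intro x i
    have hL := period_pos (L := L) i
    rw [← lintegral_add_left_eq_self (μ := (volume : Measure (AddCircle (L i))))
      (fun t => G (Function.update x i t)) (x i)]
    simp only [← hup]
    have hcs : Continuous fun t : AddCircle (L i) => x + (Pi.single i t : FlatTorus L) :=
      continuous_const.add (continuous_single i)
    have hms : Measurable fun t : AddCircle (L i) => ENNReal.ofReal ℓ⁻¹ * ‖f (x + (Pi.single i t : FlatTorus L))‖ₑ :=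
      hfm.comp hcs.measurable
    simp only [G]
    rw [lintegral_add_left hms]
    set I := ∫⁻ t : AddCircle (L i), ‖grad L f (x + (Pi.single i t : FlatTorus L))‖ₑ
    have h1 : ∀ t : AddCircle (L i), ‖f x‖ₑ ≤ ‖f (x + (Pi.single i t : FlatTorus L))‖ₑ + I := by
      intro t
      calc ‖f x‖ₑ = ‖f (x + (Pi.single i t : FlatTorus L)) - (f (x + (Pi.single i t : FlatTorus L)) - f x)‖ₑ := by
            rw [sub_sub_cancel]
        _ ≤ ‖f (x + (Pi.single i t : FlatTorus L))‖ₑ + ‖f (x + (Pi.single i t : FlatTorus L)) - f x‖ₑ := _root_.enorm_sub_le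
        _ ≤ _ := by
            refine add_le_add le_rfl ?_
            refine (h.enorm_sub_le x i t).trans (lintegral_mono fun τ => enorm_pderiv_le i _)
    have hLe : ENNReal.ofReal (L i)⁻¹ * ENNReal.ofReal (L i) = 1 := by
      rw [← ENNReal.ofReal_mul (by positivity), inv_mul_cancel₀ hL.ne', ENNReal.ofReal_one]
    calc ‖f x‖ₑ = ∫⁻ _ : AddCircle (L i), ENNReal.ofReal (L i)⁻¹ * ‖f x‖ₑ := by
          rw [lintegral_const, AddCircle.measure_univ, mul_right_comm, hLe, one_mul]
      _ ≤ ∫⁻ t : AddCircle (L i), (ENNReal.ofReal ℓ⁻¹ * ‖f (x + (Pi.single i t : FlatTorus L))‖ₑ +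
            ENNReal.ofReal (L i)⁻¹ * I) := by
          refine lintegral_mono fun t => ?_
          refine (mul_le_mul_right (h1 t) _).trans ?_
          rw [mul_add]
          refine add_le_add (mul_le_mul_left ?_ _) le_rfl
          exact ENNReal.ofReal_le_ofReal (inv_anti₀ hℓ (hℓL i))
      _ = _ := by
          rw [lintegral_add_left hms, lintegral_const, AddCircle.measure_univ, mul_right_comm, hLe,
            one_mul]
  have hprod : ∀ x, ‖f x‖ₑ ^ q ≤
      ∏ i, (∫⁻ t, G (Function.update x i t)) ^ ((1 : ℝ) / ((Fintype.card (Fin n) : ℝ) - 1)) := by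
    intro x
    rw [Fintype.card_fin]
    have hnn : (0 : ℝ) < (n : ℝ) - 1 := by linarith
    calc ‖f x‖ₑ ^ q = ∏ _i : Fin n, ‖f x‖ₑ ^ ((1 : ℝ) / ((n : ℝ) - 1)) := by
          rw [Finset.prod_const, Finset.card_univ, Fintype.card_fin, ← ENNReal.rpow_natCast,
            ← ENNReal.rpow_mul]
          congr 1
          rw [hq.conjugate_eq]
          ring
      _ ≤ _ := by
          gcongr with i
          exact hG x i
  have hP : ∫⁻ x, ‖f x‖ₑ ≤ ENNReal.ofReal (n * (Λ * ℓ)) * ∫⁻ x, ‖grad L f x‖ₑ := by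
    refine (h.lintegral_enorm_le h0).trans ?_
    calc ∑ i, ENNReal.ofReal (L i) * ∫⁻ x, ‖pderiv L i f x‖ₑ
        ≤ ∑ _i : Fin n, ENNReal.ofReal (Λ * ℓ) * ∫⁻ x, ‖grad L f x‖ₑ := by
          refine Finset.sum_le_sum fun i _ => ?_
          exact mul_le_mul' (ENNReal.ofReal_le_ofReal (hLΛ i))
            (lintegral_mono fun x => enorm_pderiv_le i x)
      _ = _ := by
          rw [Finset.sum_const, Finset.card_univ, Fintype.card_fin, nsmul_eq_mul,
            ENNReal.ofReal_mul n.cast_nonneg, ENNReal.ofReal_natCast, mul_assoc]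
  have hGI : ∫⁻ x, G x ≤ ENNReal.ofReal (n * Λ + 1) * ∫⁻ x, ‖grad L f x‖ₑ := by
    simp only [G]
    rw [lintegral_add_left hfm, lintegral_const_mul' _ _ (by finiteness)]
    refine (add_le_add_left (mul_le_mul_right hP _) _).trans (le_of_eq ?_)
    rw [← mul_assoc, ← ENNReal.ofReal_mul (by positivity),
      ENNReal.ofReal_add (by positivity) zero_le_one, ENNReal.ofReal_one, add_mul, one_mul]
    congr 3
    field_simp
  -- The grid-lines inequality of Gagliardo and Nirenberg: the product of the line integrals of `G`,
  -- each to the power `1/(n-1)`, has integral at most `(∫ G)^q`.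
  have hgrid := lintegral_prod_lintegral_pow_le (fun i => (volume : Measure (AddCircle (L i))))
    (p := q) (by simpa using hq) hGm
  refine (lintegral_mono hprod).trans (hgrid.trans ?_)
  exact ENNReal.rpow_le_rpow hGI hq.symm.nonneg

end

/-! ### Counting lattice points in cubes. -/

section

variable {n : ℕ}

/-- The maximum norm of a lattice point. -/
def supNorm (m : Fin n → ℤ) : ℕ := Finset.univ.sup fun i => (m i).natAbs

theorem supNorm_le_iff {m : Fin n → ℤ} {N : ℕ} : supNorm m ≤ N ↔ ∀ i, |m i| ≤ (N : ℤ) := by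
  simp only [supNorm, Finset.sup_le_iff, Finset.mem_univ, true_imp_iff]
  exact forall_congr' fun i => by rw [Int.abs_eq_natAbs, Nat.cast_le]

theorem supNorm_eq_zero_iff {m : Fin n → ℤ} : supNorm m = 0 ↔ m = 0 := by
  rw [← Nat.le_zero, supNorm_le_iff]
  simp [funext_iff]

theorem supNorm_pos {m : Fin n → ℤ} (hm : m ≠ 0) : 0 < supNorm m :=
  Nat.pos_of_ne_zero fun h => hm (supNorm_eq_zero_iff.1 h)

/-- The lattice cube `supNorm m ≤ N`. -/
def box (n N : ℕ) : Finset (Fin n → ℤ) := Fintype.piFinset fun _ => Finset.Icc (-(N : ℤ)) N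

theorem mem_box {m : Fin n → ℤ} {N : ℕ} : m ∈ box n N ↔ supNorm m ≤ N := by
  simp only [box, Fintype.mem_piFinset, Finset.mem_Icc, supNorm_le_iff, abs_le]

theorem card_box (N : ℕ) : (box n N).card = (2 * N + 1) ^ n := by
  simp only [box, Fintype.card_piFinset, Int.card_Icc, Finset.prod_const, Finset.card_univ,
    Fintype.card_fin]
  congr 1
  omega

theorem exists_subset_box (F : Finset (Fin n → ℤ)) : ∃ N, F ⊆ box n N :=
  ⟨F.sup supNorm, fun _ hm => mem_box.2 (Finset.le_sup hm)⟩

theorem add_one_pow_sub_pow_le (x : ℝ) (hx : 0 ≤ x) {d : ℝ} (hd : 0 ≤ d) (k : ℕ) :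
    (x + d) ^ k - x ^ k ≤ d * k * (x + d) ^ (k - 1) := by
  have h := abs_pow_sub_pow_le (x + d) x k
  rw [add_sub_cancel_left, abs_of_nonneg hd, abs_of_nonneg (by positivity : 0 ≤ x + d),
    abs_of_nonneg hx, max_eq_left (by linarith)] at h
  exact (le_abs_self _).trans h

/-- In dimension `k + 2` the shell `supNorm m = j` has about `j^{k+1}` points, each contributing
`j^{-k}`; the shells sum to about `N²`. -/
theorem sum_inv_pow_supNorm_le (k N : ℕ) :
    ∑ m ∈ (box (k + 2) N).erase 0, ((supNorm m : ℝ) ^ k)⁻¹ ≤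
      2 * (k + 2) * 3 ^ (k + 1) * (N : ℝ) ^ 2 := by
  induction N with
  | zero =>
    refine le_of_eq ?_
    rw [Finset.sum_eq_zero]
    · simp
    · intro m hm
      rw [Finset.mem_erase, mem_box, Nat.le_zero, supNorm_eq_zero_iff] at hm
      exact absurd hm.2 hm.1
  | succ N ih =>
    have hsub : box (k + 2) N ⊆ box (k + 2) (N + 1) := fun m hm =>
      mem_box.2 ((mem_box.1 hm).trans N.le_succ)
    have h0 : (0 : Fin (k + 2) → ℤ) ∈ box (k + 2) N := mem_box.2 (by simp [supNorm])
    have hsplit : (box (k + 2) (N + 1)).erase 0 =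
        (box (k + 2) N).erase 0 ∪ (box (k + 2) (N + 1) \ box (k + 2) N) := by
      ext m
      simp only [Finset.mem_erase, Finset.mem_union, Finset.mem_sdiff]
      constructor
      · rintro ⟨h1, h2⟩
        by_cases h3 : m ∈ box (k + 2) N
        · exact Or.inl ⟨h1, h3⟩
        · exact Or.inr ⟨h2, h3⟩
      · rintro (⟨h1, h2⟩ | ⟨h1, h2⟩)
        · exact ⟨h1, hsub h2⟩
        · exact ⟨fun h => h2 (h ▸ h0), h1⟩
    have hdisj : Disjoint ((box (k + 2) N).erase 0) (box (k + 2) (N + 1) \ box (k + 2) N) :=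
      Finset.disjoint_left.2 fun m h1 h2 => (Finset.mem_sdiff.1 h2).2 (Finset.mem_of_mem_erase h1)
    rw [hsplit, Finset.sum_union hdisj]
    have hcard : ((box (k + 2) (N + 1) \ box (k + 2) N).card : ℝ) ≤
        2 * (k + 2) * 3 ^ (k + 1) * ((N : ℝ) + 1) ^ (k + 1) := by
      rw [Finset.card_sdiff_of_subset hsub, Nat.cast_sub (Finset.card_le_card hsub), card_box, card_box]
      have h1 := add_one_pow_sub_pow_le (2 * N + 1 : ℝ) (by positivity) (d := 2) (by norm_num) (k + 2)
      push_cast at h1 ⊢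
      have h2 : (2 * ((N : ℝ) + 1) + 1) = 2 * N + 1 + 2 := by ring
      rw [h2]
      refine h1.trans ?_
      rw [mul_assoc (2 * ((k : ℝ) + 2)), ← mul_pow]
      gcongr
      linarith
    have hsum : ∑ m ∈ box (k + 2) (N + 1) \ box (k + 2) N, ((supNorm m : ℝ) ^ k)⁻¹ ≤
        2 * (k + 2) * 3 ^ (k + 1) * ((N : ℝ) + 1) := by
      calc ∑ m ∈ box (k + 2) (N + 1) \ box (k + 2) N, ((supNorm m : ℝ) ^ k)⁻¹
          = ∑ m ∈ box (k + 2) (N + 1) \ box (k + 2) N, (((N : ℝ) + 1) ^ k)⁻¹ := by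
            refine Finset.sum_congr rfl fun m hm => ?_
            rw [Finset.mem_sdiff, mem_box, mem_box] at hm
            have : supNorm m = N + 1 := by omega
            rw [this]
            push_cast
            rfl
        _ ≤ 2 * (k + 2) * 3 ^ (k + 1) * ((N : ℝ) + 1) ^ (k + 1) * (((N : ℝ) + 1) ^ k)⁻¹ := by
            rw [Finset.sum_const, nsmul_eq_mul]
            gcongr
        _ = _ := by
            rw [pow_succ ((N : ℝ) + 1)]
            field_simp
    push_cast
    have hK : (0 : ℝ) ≤ 2 * (k + 2) * 3 ^ (k + 1) := by positivity
    nlinarith [mul_nonneg hK (Nat.cast_nonneg (α := ℝ) N)]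

theorem pow_le_mul_sum_range {k : ℕ} (hk : 1 ≤ k) (J : ℕ) :
    (J : ℝ) ^ k ≤ k * ∑ N ∈ Finset.range J, ((N : ℝ) + 1) ^ (k - 1) := by
  induction J with
  | zero => simp [Nat.ne_of_gt hk]
  | succ J ih =>
    rw [Finset.sum_range_succ, mul_add]
    have := add_one_pow_sub_pow_le (J : ℝ) J.cast_nonneg zero_le_one k
    push_cast
    linarith

theorem sum_range_le_pow {k : ℕ} (hk : 1 ≤ k) (J : ℕ) :
    ∑ N ∈ Finset.range J, ((N : ℝ) + 1) ^ (k - 1) ≤ (J : ℝ) ^ k := by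
  calc ∑ N ∈ Finset.range J, ((N : ℝ) + 1) ^ (k - 1)
      ≤ ∑ _N ∈ Finset.range J, (J : ℝ) ^ (k - 1) := by
        refine Finset.sum_le_sum fun N hN => ?_
        gcongr
        exact_mod_cast Finset.mem_range.1 hN
    _ = _ := by
        rw [Finset.sum_const, Finset.card_range, nsmul_eq_mul, ← pow_succ', Nat.sub_add_cancel hk]

/-! ### Parseval and the critical Sobolev embedding. -/

variable {L : Fin n → ℝ} [∀ i, Fact (0 < L i)]

theorem integral_norm_sq_sum_char (F : Finset (Fin n → ℤ)) (c : (Fin n → ℤ) → ℂ) :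
    ∫ x, ‖∑ m ∈ F, c m * char L m x‖ ^ 2 = vol L * ∑ m ∈ F, ‖c m‖ ^ 2 := by
  have h1 : ∀ x, ((‖∑ m ∈ F, c m * char L m x‖ ^ 2 : ℝ) : ℂ) =
      ∑ m ∈ F, ∑ j ∈ F, (c m * starRingEnd ℂ (c j)) * char L (m - j) x := by
    intro x
    rw [← Complex.normSq_eq_norm_sq, ← Complex.mul_conj, map_sum, Finset.sum_mul_sum]
    refine Finset.sum_congr rfl fun m _ => Finset.sum_congr rfl fun j _ => ?_
    rw [map_mul, char_sub_index]
    ring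
  have hi : ∀ m j, Integrable fun x => (c m * starRingEnd ℂ (c j)) * char L (m - j) x :=
    fun m j => integrable_of_continuous _ (continuous_const.mul (continuous_char L _))
  have h2 : ((∫ x, ‖∑ m ∈ F, c m * char L m x‖ ^ 2 : ℝ) : ℂ) =
      ((vol L * ∑ m ∈ F, ‖c m‖ ^ 2 : ℝ) : ℂ) := by
    rw [← integral_complex_ofReal]
    simp only [h1]
    rw [integral_finsetSum _ fun m _ => integrable_finsetSum _ fun j _ => hi m j]
    simp only [integral_finsetSum _ fun j _ => hi _ j, integral_const_mul, integral_char,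
      sub_eq_zero, mul_ite, mul_zero, Finset.sum_ite_eq]
    rw [Complex.ofReal_mul, Complex.ofReal_sum, Finset.mul_sum]
    refine Finset.sum_congr rfl fun m hm => ?_
    rw [if_pos hm, Complex.mul_conj, Complex.normSq_eq_norm_sq]
    ring
  exact_mod_cast h2

/-- The constant in the critical Sobolev embedding of order `k / 2` in dimension `k + 2`. -/
def sobolevConst (k : ℕ) : ℝ := 4 * k * (2 * √(2 * (k + 2) * 3 ^ (k + 1))) ^ k

/-- Cauchy–Schwarz with weight `|m|^k`; the dual weights sum to at most a constant times `N²`,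
whence a bound linear in `N`. -/
theorem norm_sum_low_le {k : ℕ} {L : Fin (k + 2) → ℝ} [∀ i, Fact (0 < L i)]
    {F : Finset (Fin (k + 2) → ℤ)} (hF : 0 ∉ F) (c : (Fin (k + 2) → ℤ) → ℂ) (N : ℕ)
    (x : FlatTorus L) :
    ‖∑ m ∈ F with supNorm m ≤ N, c m * char L m x‖ ≤
      N * (√(2 * (k + 2) * 3 ^ (k + 1)) * √(∑ m ∈ F, (supNorm m : ℝ) ^ k * ‖c m‖ ^ 2)) := by
  rw [← Real.sqrt_mul (by positivity), ← Real.sqrt_sq (N.cast_nonneg : (0 : ℝ) ≤ N),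
    ← Real.sqrt_mul (by positivity)]
  refine Real.le_sqrt_of_sq_le ?_
  have hpos : ∀ m ∈ F, (0 : ℝ) < (supNorm m : ℝ) ^ k := by
    intro m hm
    have := supNorm_pos (m := m) (fun h => hF (h ▸ hm))
    positivity
  have h1 : ‖∑ m ∈ F with supNorm m ≤ N, c m * char L m x‖ ≤
      ∑ m ∈ F with supNorm m ≤ N, (√((supNorm m : ℝ) ^ k))⁻¹ * (√((supNorm m : ℝ) ^ k) * ‖c m‖) := by
    refine (norm_sum_le _ _).trans (le_of_eq (Finset.sum_congr rfl fun m hm => ?_))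
    have := Real.sqrt_pos.2 (hpos m (Finset.mem_of_mem_filter m hm))
    rw [norm_mul, norm_char, mul_one]
    field_simp
  calc ‖∑ m ∈ F with supNorm m ≤ N, c m * char L m x‖ ^ 2
      ≤ (∑ m ∈ F with supNorm m ≤ N,
          (√((supNorm m : ℝ) ^ k))⁻¹ * (√((supNorm m : ℝ) ^ k) * ‖c m‖)) ^ 2 := by gcongr
    _ ≤ (∑ m ∈ F with supNorm m ≤ N, (√((supNorm m : ℝ) ^ k))⁻¹ ^ 2) *
        ∑ m ∈ F with supNorm m ≤ N, (√((supNorm m : ℝ) ^ k) * ‖c m‖) ^ 2 :=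
        Finset.sum_mul_sq_le_sq_mul_sq _ _ _
    _ ≤ (2 * (k + 2) * 3 ^ (k + 1) * (N : ℝ) ^ 2) *
        ∑ m ∈ F, (supNorm m : ℝ) ^ k * ‖c m‖ ^ 2 := by
        have e1 : ∀ m : Fin (k + 2) → ℤ, (√((supNorm m : ℝ) ^ k))⁻¹ ^ 2 = ((supNorm m : ℝ) ^ k)⁻¹ := by
          intro m
          rw [inv_pow, Real.sq_sqrt (by positivity)]
        have e2 : ∀ m : Fin (k + 2) → ℤ, (√((supNorm m : ℝ) ^ k) * ‖c m‖) ^ 2 =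
            (supNorm m : ℝ) ^ k * ‖c m‖ ^ 2 := by
          intro m
          rw [mul_pow, Real.sq_sqrt (by positivity)]
        simp only [e1, e2]
        gcongr
        · refine le_trans ?_ (sum_inv_pow_supNorm_le k N)
          refine Finset.sum_le_sum_of_subset_of_nonneg (fun m hm => ?_) fun m _ _ => by positivity
          rw [Finset.mem_filter] at hm
          exact Finset.mem_erase.2 ⟨fun h => hF (h ▸ hm.1), mem_box.2 hm.2⟩
        exact Finset.filter_subset _ _
    _ = _ := by ring

/-- A pointwise, discrete form of the level-set proof of Sobolev embedding. As long as `2NA <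
|f(x)|`, the frequencies up to `N` account for less than half of `|f(x)|`, so the remainder beyond
`N` carries at least half. Summing over such `N` with weights `(N+1)^{k-1}` recovers `|f(x)|^k` from
the number of them. Integration then needs only Parseval. -/
theorem norm_pow_le_sum_high {k : ℕ} (hk : 1 ≤ k) {L : Fin (k + 2) → ℝ} [∀ i, Fact (0 < L i)]
    {F : Finset (Fin (k + 2) → ℤ)} (hF : 0 ∉ F) (c : (Fin (k + 2) → ℤ) → ℂ) {M : ℕ}
    (hM : F ⊆ box (k + 2) M) {A : ℝ}
    (hA : A = √(2 * (k + 2) * 3 ^ (k + 1)) * √(∑ m ∈ F, (supNorm m : ℝ) ^ k * ‖c m‖ ^ 2))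
    (x : FlatTorus L) :
    ‖∑ m ∈ F, c m * char L m x‖ ^ (k + 2) ≤
      4 * k * (2 * A) ^ k * ∑ N ∈ Finset.range M, ((N : ℝ) + 1) ^ (k - 1) *
        ‖∑ m ∈ F with N < supNorm m, c m * char L m x‖ ^ 2 := by
  have hA0 : 0 ≤ A := by rw [hA]; positivity
  set g : ℕ → ℂ := fun N => ∑ m ∈ F with N < supNorm m, c m * char L m x
  have hsplit : ∀ N, ∑ m ∈ F, c m * char L m x =
      ∑ m ∈ F with supNorm m ≤ N, c m * char L m x + g N := by
    intro N
    rw [← Finset.sum_filter_add_sum_filter_not F (fun m => supNorm m ≤ N)]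
    simp only [not_le, g]
  set y := ‖∑ m ∈ F, c m * char L m x‖ with hy
  have hy0 : 0 ≤ y := norm_nonneg _
  have hlow : ∀ N : ℕ, y ≤ N * A + ‖g N‖ := by
    intro N
    rw [hy, hsplit N]
    refine (norm_add_le _ _).trans ?_
    gcongr
    rw [hA]
    exact norm_sum_low_le hF c N x
  have hgM : g M = 0 := by
    refine Finset.sum_eq_zero fun m hm => ?_
    rw [Finset.mem_filter] at hm
    exact absurd (mem_box.1 (hM hm.1)) (not_le.2 hm.2)
  rcases hA0.eq_or_lt with h0 | h0
  · have : y = 0 := by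
      have := hlow M
      rw [hgM, ← h0] at this
      simp at this
      exact le_antisymm this hy0
    rw [this, zero_pow (by omega)]
    positivity
  -- The condition `N < J` says exactly `2NA < y`. Moreover `J ≤ M`, since no frequency lies beyond
  -- `M`.
  · set J := ⌈y / (2 * A)⌉₊
    have hJy : y ≤ 2 * A * J := by
      rw [← div_le_iff₀' (by positivity)]
      exact Nat.le_ceil _
    have hNJ : ∀ N < J, y ≤ 2 * ‖g N‖ ∧ 0 < y := by
      intro N hN
      have h1 := Nat.lt_ceil.1 hN
      rw [lt_div_iff₀ (by positivity)] at h1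
      have h2 := hlow N
      have h3 : (0 : ℝ) ≤ N * (2 * A) := by positivity
      exact ⟨by nlinarith, by linarith⟩
    have hJM : J ≤ M := by
      by_contra hlt
      have := hNJ M (by omega)
      rw [hgM] at this
      simp at this
      linarith
    calc y ^ (k + 2) = y ^ 2 * y ^ k := by ring
      _ ≤ y ^ 2 * ((2 * A) ^ k * (k * ∑ N ∈ Finset.range J, ((N : ℝ) + 1) ^ (k - 1))) := by
          gcongr
          calc y ^ k ≤ (2 * A * J) ^ k := by gcongr
            _ = (2 * A) ^ k * (J : ℝ) ^ k := by rw [mul_pow]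
            _ ≤ _ := by
              gcongr
              exact pow_le_mul_sum_range hk J
      _ = k * (2 * A) ^ k * ∑ N ∈ Finset.range J, ((N : ℝ) + 1) ^ (k - 1) * y ^ 2 := by
          rw [← Finset.sum_mul]; ring
      _ ≤ k * (2 * A) ^ k * ∑ N ∈ Finset.range J, ((N : ℝ) + 1) ^ (k - 1) * (4 * ‖g N‖ ^ 2) := by
          gcongr with N hN
          have := (hNJ N (Finset.mem_range.1 hN)).1
          nlinarith
      _ ≤ k * (2 * A) ^ k * ∑ N ∈ Finset.range M, ((N : ℝ) + 1) ^ (k - 1) * (4 * ‖g N‖ ^ 2) := by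
          gcongr
      _ = _ := by
          simp only [mul_left_comm _ (4 : ℝ), ← Finset.mul_sum]
          ring

/-- The critical Sobolev embedding for trigonometric polynomials. -/
theorem integral_norm_pow_le {k : ℕ} (hk : 1 ≤ k) {L : Fin (k + 2) → ℝ} [∀ i, Fact (0 < L i)]
    {F : Finset (Fin (k + 2) → ℤ)} (hF : 0 ∉ F) (c : (Fin (k + 2) → ℤ) → ℂ) :
    ∫ x, ‖∑ m ∈ F, c m * char L m x‖ ^ (k + 2) ≤
      sobolevConst k * vol L * √(∑ m ∈ F, (supNorm m : ℝ) ^ k * ‖c m‖ ^ 2) ^ (k + 2) := by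
  set E := √(∑ m ∈ F, (supNorm m : ℝ) ^ k * ‖c m‖ ^ 2) with hE
  set A := √(2 * (k + 2) * 3 ^ (k + 1)) * E with hA
  have hA0 : 0 ≤ A := by positivity
  obtain ⟨M, hM⟩ := exists_subset_box F
  let g : ℕ → FlatTorus L → ℂ := fun N x => ∑ m ∈ F with N < supNorm m, c m * char L m x
  have hgc : ∀ N, Continuous (g N) := fun N =>
    continuous_finsetSum _ fun m _ => continuous_const.mul (continuous_char L m)
  have hpt := norm_pow_le_sum_high hk (L := L) hF c hM hA
  have hgi : ∀ N : ℕ, Integrable fun x => ((N : ℝ) + 1) ^ (k - 1) * ‖g N x‖ ^ 2 := fun N =>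
    integrable_of_continuous _ (continuous_const.mul ((hgc N).norm.pow 2))
  have hfi : Integrable fun x => ‖∑ m ∈ F, c m * char L m x‖ ^ (k + 2) :=
    integrable_of_continuous _ ((continuous_finsetSum _ fun m _ =>
      continuous_const.mul (continuous_char L m)).norm.pow _)
  have hV := vol_pos (L := L)
  have hE2 : E ^ 2 = ∑ m ∈ F, (supNorm m : ℝ) ^ k * ‖c m‖ ^ 2 :=
    Real.sq_sqrt (Finset.sum_nonneg fun m _ => by positivity)
  calc ∫ x, ‖∑ m ∈ F, c m * char L m x‖ ^ (k + 2)
      ≤ ∫ x, 4 * k * (2 * A) ^ k * ∑ N ∈ Finset.range M, ((N : ℝ) + 1) ^ (k - 1) * ‖g N x‖ ^ 2 :=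
        integral_mono hfi ((integrable_finsetSum _ fun N _ => hgi N).const_mul _) hpt
    _ = 4 * k * (2 * A) ^ k * ∑ N ∈ Finset.range M, ((N : ℝ) + 1) ^ (k - 1) *
          (vol L * ∑ m ∈ F with N < supNorm m, ‖c m‖ ^ 2) := by
        rw [integral_const_mul, integral_finsetSum _ fun N _ => hgi N]
        simp only [integral_const_mul, g, integral_norm_sq_sum_char]
    -- With the sums exchanged, each `m` collects the weights of all `N < supNorm m`, which add up
    -- to at most `supNorm m ^ k`.
    _ = 4 * k * (2 * A) ^ k * vol L * ∑ m ∈ F, ‖c m‖ ^ 2 *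
          ∑ N ∈ Finset.range M with N < supNorm m, ((N : ℝ) + 1) ^ (k - 1) := by
        rw [mul_assoc _ (vol L)]
        congr 1
        simp only [Finset.sum_filter, Finset.mul_sum]
        rw [Finset.sum_comm]
        refine Finset.sum_congr rfl fun m _ => Finset.sum_congr rfl fun N _ => ?_
        split_ifs <;> ring
    _ ≤ 4 * k * (2 * A) ^ k * vol L * ∑ m ∈ F, ‖c m‖ ^ 2 * (supNorm m : ℝ) ^ k := by
        gcongr with m hm
        refine le_trans ?_ (sum_range_le_pow hk _)
        refine Finset.sum_le_sum_of_subset_of_nonneg (fun N hN => ?_) fun N _ _ => by positivity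
        exact Finset.mem_range.2 (Finset.mem_filter.1 hN).2
    _ = 4 * k * (2 * A) ^ k * vol L * E ^ 2 := by
        rw [hE2]
        simp only [mul_comm]
    _ = _ := by
        rw [hA, sobolevConst, pow_add E]
        rw [← mul_assoc 2, mul_pow _ E]
        ring

end

/-! ### The critical bound of the negative Sobolev norm by the total variation. -/

section

theorem supNorm_le_norm_freq {n : ℕ} {L : Fin n → ℝ} [∀ i, Fact (0 < L i)] {D : ℝ}
    (hLD : ∀ i, L i ≤ D) (m : Fin n → ℤ) : supNorm m / D ≤ ‖freq L m‖ := by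
  rcases Nat.eq_zero_or_pos n with rfl | hn
  · simp [supNorm]
  obtain ⟨i, -, hi⟩ := Finset.exists_mem_eq_sup (Finset.univ : Finset (Fin n))
    ⟨⟨0, hn⟩, Finset.mem_univ _⟩ fun i => (m i).natAbs
  have hL := period_pos (L := L) i
  calc (supNorm m : ℝ) / D ≤ supNorm m / L i := by
        gcongr
        exact hLD i
    _ = ‖freq L m i‖ := by
        have h1 : ((m i).natAbs : ℝ) = |(m i : ℝ)| := by
          rw [← Int.cast_abs, Int.abs_eq_natAbs, Int.cast_natCast]
        rw [supNorm, hi, h1]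
        simp [freq, abs_of_pos hL]
    _ ≤ ‖freq L m‖ := PiLp.norm_apply_le _ _

/-- Duality of the critical Sobolev embedding with the Gagliardo–Nirenberg inequality. -/
theorem IsTrig.sum_le_critical {k : ℕ} (hk : 1 ≤ k) {L : Fin (k + 2) → ℝ} [∀ i, Fact (0 < L i)]
    {S : Finset (Fin (k + 2) → ℤ)} {c : (Fin (k + 2) → ℤ) → ℂ} {φ : FlatTorus L → ℝ}
    (h : IsTrig L S c φ) (h0 : ∫ x, φ x = 0)
    {ℓ Λ : ℝ} (hℓ : 0 < ℓ) (hℓL : ∀ i, ℓ ≤ L i) (hLΛ : ∀ i, L i ≤ Λ * ℓ)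
    {T : ℝ} (hT : ∫ x, ‖grad L φ x‖ ≤ T) :
    (ℓ ^ k * vol L) * ∑ m ∈ S.erase 0, ((supNorm m : ℝ) ^ k)⁻¹ * ‖c m‖ ^ 2 ≤
      (sobolevConst k ^ (1 / ((k : ℝ) + 2)) * (((k : ℝ) + 2) * Λ + 1) * T) ^ 2 := by
  set B : ℝ := ((k : ℝ) + 2) * Λ + 1
  have hV := vol_pos (L := L)
  have hC : 0 < sobolevConst k := by unfold sobolevConst; positivity
  have hΛ : 0 ≤ Λ := by
    have h1 := (hℓL 0).trans (hLΛ 0)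
    by_contra h2
    nlinarith
  have hB : 0 < B := by positivity
  have hT0 : 0 ≤ T := (integral_nonneg fun x => norm_nonneg _).trans hT
  set F := S.erase 0
  have hF : (0 : Fin (k + 2) → ℤ) ∉ F := Finset.notMem_erase _ _
  have hpos : ∀ m ∈ F, (0 : ℝ) < (supNorm m : ℝ) ^ k := by
    intro m hm
    have := supNorm_pos (m := m) (fun h => hF (h ▸ hm))
    positivity
  set Q := ∑ m ∈ F, ((supNorm m : ℝ) ^ k)⁻¹ * ‖c m‖ ^ 2
  have hQ0 : 0 ≤ Q := Finset.sum_nonneg fun m _ => by positivity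
  -- The extremal function of the duality: its pairing with `φ` is `vol L * Q`, while its Sobolev
  -- energy is again `Q`, so that Hölder's inequality leaves a factor `√Q` to cancel.
  set d : (Fin (k + 2) → ℤ) → ℂ := fun m => (((supNorm m : ℝ) ^ k)⁻¹ : ℝ) * c m
  have hdQ : ∑ m ∈ F, (supNorm m : ℝ) ^ k * ‖d m‖ ^ 2 = Q := by
    refine Finset.sum_congr rfl fun m hm => ?_
    have := hpos m hm
    simp only [d]
    rw [norm_mul, Complex.norm_real, Real.norm_of_nonneg (by positivity)]
    field_simp
  let g : FlatTorus L → ℂ := fun x => ∑ m ∈ F, d m * char L m x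
  have hg : Continuous g :=
    continuous_finsetSum _ fun m _ => continuous_const.mul (continuous_char L m)
  have hdual : ∫ x, starRingEnd ℂ (g x) * (φ x : ℂ) = ((vol L * Q : ℝ) : ℂ) := by
    have h1 : ∀ x, starRingEnd ℂ (g x) * (φ x : ℂ) =
        ∑ m ∈ F, starRingEnd ℂ (d m) * (char L (-m) x * (φ x : ℂ)) := by
      intro x
      simp only [g]
      rw [map_sum, Finset.sum_mul]
      refine Finset.sum_congr rfl fun m _ => ?_
      rw [map_mul, char_neg_index, mul_assoc]
    simp only [h1]
    rw [integral_finsetSum]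
    · simp only [integral_const_mul, h.integral_char_mul, neg_neg]
      rw [Complex.ofReal_mul, Complex.ofReal_sum, Finset.mul_sum]
      refine Finset.sum_congr rfl fun m hm => ?_
      rw [if_pos (Finset.mem_of_mem_erase hm)]
      have h3 : starRingEnd ℂ (c m) * c m = ((‖c m‖ ^ 2 : ℝ) : ℂ) := by
        rw [mul_comm, Complex.mul_conj, Complex.normSq_eq_norm_sq]
      simp only [d]
      rw [map_mul, Complex.conj_ofReal, Complex.ofReal_mul, ← h3]
      ring
    · intro m _
      exact integrable_of_continuous _ (continuous_const.mul ((continuous_char L _).mul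
        (Complex.continuous_ofReal.comp h.continuous)))
  have hn : (1 : ℝ) < ((k + 2 : ℕ) : ℝ) := by
    push_cast
    have : (0 : ℝ) ≤ k := k.cast_nonneg
    linarith
  have hq := Real.HolderConjugate.conjExponent hn
  set q := Real.conjExponent ((k + 2 : ℕ) : ℝ)
  have hGN := h.lintegral_rpow_le h0 hq hℓ hℓL hLΛ
  have hgrad : ∫⁻ x, ‖grad L φ x‖ₑ ≤ ENNReal.ofReal T := by
    rw [← ofReal_integral_norm_eq_lintegral_enorm
      (integrable_of_continuous _ (continuous_grad_of_isTrig L h))]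
    exact ENNReal.ofReal_le_ofReal hT
  have hφq : (∫⁻ x, ‖φ x‖ₑ ^ q) ^ (1 / q) ≤ ENNReal.ofReal (B * T) := by
    have hq0 : 0 < q := hq.symm.pos
    rw [one_div, ENNReal.rpow_inv_le_iff hq0]
    refine hGN.trans ?_
    gcongr
    rw [ENNReal.ofReal_mul hB.le]
    refine mul_le_mul' (le_of_eq ?_) hgrad
    simp only [B]
    push_cast
    rfl
  have hgn : (∫⁻ x, ‖g x‖ₑ ^ ((k + 2 : ℕ) : ℝ)) ^ (1 / ((k + 2 : ℕ) : ℝ)) ≤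
      ENNReal.ofReal (sobolevConst k ^ (1 / ((k : ℝ) + 2)) * vol L ^ (1 / ((k : ℝ) + 2)) * √Q) := by
    have h1 := integral_norm_pow_le hk (L := L) hF d
    rw [hdQ] at h1
    rw [one_div, ENNReal.rpow_inv_le_iff (by positivity), ENNReal.rpow_natCast,
      ← ENNReal.ofReal_pow (by positivity)]
    have h2 : ∫⁻ x, ‖g x‖ₑ ^ ((k + 2 : ℕ) : ℝ) = ENNReal.ofReal (∫ x, ‖g x‖ ^ (k + 2)) := by
      rw [ofReal_integral_eq_lintegral_ofReal]
      · refine lintegral_congr fun x => ?_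
        rw [ENNReal.rpow_natCast, ← ofReal_norm, ENNReal.ofReal_pow (norm_nonneg _)]
      · exact integrable_of_continuous _ (hg.norm.pow _)
      · exact Filter.Eventually.of_forall fun x => by positivity
    rw [h2]
    refine ENNReal.ofReal_le_ofReal (h1.trans (le_of_eq ?_))
    have h3 : ∀ y : ℝ, 0 ≤ y → (y ^ (1 / ((k : ℝ) + 2))) ^ (k + 2) = y := by
      intro y hy
      rw [← Real.rpow_natCast, ← Real.rpow_mul hy]
      push_cast
      rw [one_div_mul_cancel (by positivity), Real.rpow_one]
    rw [mul_pow, mul_pow, h3 _ hC.le, h3 _ hV.le]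
  have hmain : vol L * Q ≤
      sobolevConst k ^ (1 / ((k : ℝ) + 2)) * vol L ^ (1 / ((k : ℝ) + 2)) * √Q * (B * T) := by
    rw [← ENNReal.ofReal_le_ofReal_iff (by positivity)]
    nth_rw 2 [ENNReal.ofReal_mul (by positivity)]
    calc ENNReal.ofReal (vol L * Q) = ‖∫ x, starRingEnd ℂ (g x) * (φ x : ℂ)‖ₑ := by
          rw [hdual, ← ofReal_norm, Complex.norm_real, Real.norm_of_nonneg (by positivity)]
      _ ≤ ∫⁻ x, ‖starRingEnd ℂ (g x) * (φ x : ℂ)‖ₑ := enorm_integral_le_lintegral_enorm _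
      _ = ∫⁻ x, ((fun x => ‖g x‖ₑ) * fun x => ‖φ x‖ₑ) x := by
          refine lintegral_congr fun x => ?_
          rw [enorm_mul, Pi.mul_apply, RCLike.enorm_conj]
          congr 1
          rw [← ofReal_norm, ← ofReal_norm, Complex.norm_real]
      _ ≤ (∫⁻ x, ‖g x‖ₑ ^ ((k + 2 : ℕ) : ℝ)) ^ (1 / ((k + 2 : ℕ) : ℝ)) *
          (∫⁻ x, ‖φ x‖ₑ ^ q) ^ (1 / q) :=
          ENNReal.lintegral_mul_le_Lp_mul_Lq _ hq hg.enorm.aemeasurable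
            h.continuous.enorm.aemeasurable
      _ ≤ _ := mul_le_mul' hgn hφq
  -- Together with `hVV` this converts the powers of the volume left by Hölder's inequality into the
  -- scale-correct factor `ℓ^k`.
  have hVℓ : ℓ ^ k ≤ vol L ^ ((k : ℝ) / (k + 2)) := by
    have h1 : ℓ ^ (k + 2) ≤ vol L := by
      calc ℓ ^ (k + 2) = ∏ _i : Fin (k + 2), ℓ := by simp
        _ ≤ _ := Finset.prod_le_prod (fun _ _ => hℓ.le) fun i _ => hℓL i
    calc ℓ ^ k = (ℓ ^ (k + 2)) ^ ((k : ℝ) / (k + 2)) := by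
          rw [← Real.rpow_natCast, ← Real.rpow_natCast, ← Real.rpow_mul hℓ.le]
          congr 1
          push_cast
          field_simp
      _ ≤ _ := by gcongr
  rcases hQ0.eq_or_lt with hQ | hQ
  · rw [← hQ, mul_zero]
    positivity
  have hsq : vol L * √Q ≤
      sobolevConst k ^ (1 / ((k : ℝ) + 2)) * vol L ^ (1 / ((k : ℝ) + 2)) * (B * T) := by
    have hs := Real.sqrt_pos.2 hQ
    refine le_of_mul_le_mul_right ?_ hs
    calc vol L * √Q * √Q = vol L * Q := by rw [mul_assoc, Real.mul_self_sqrt hQ0]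
      _ ≤ _ := hmain
      _ = _ := by ring
  have hVV : vol L ^ ((k : ℝ) / (k + 2)) * vol L * (vol L ^ (1 / ((k : ℝ) + 2))) ^ 2 = vol L ^ 2 := by
    rw [← Real.rpow_natCast _ 2, ← Real.rpow_mul hV.le, ← Real.rpow_add_one hV.ne',
      ← Real.rpow_add hV, ← Real.rpow_natCast]
    congr 1
    push_cast
    field_simp
    ring
  have hW : 0 < (vol L ^ (1 / ((k : ℝ) + 2))) ^ 2 := by positivity
  refine le_of_mul_le_mul_right ?_ hW
  calc ℓ ^ k * vol L * Q * (vol L ^ (1 / ((k : ℝ) + 2))) ^ 2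
      ≤ vol L ^ ((k : ℝ) / (k + 2)) * vol L * Q * (vol L ^ (1 / ((k : ℝ) + 2))) ^ 2 := by gcongr
    _ = (vol L ^ ((k : ℝ) / (k + 2)) * vol L * (vol L ^ (1 / ((k : ℝ) + 2))) ^ 2) * Q := by ring
    _ = (vol L * √Q) ^ 2 := by rw [hVV, mul_pow, Real.sq_sqrt hQ0]
    _ ≤ (sobolevConst k ^ (1 / ((k : ℝ) + 2)) * vol L ^ (1 / ((k : ℝ) + 2)) * (B * T)) ^ 2 := by
        gcongr
    _ = _ := by ring

/-- `IsTrig.sum_le_critical` applied to a mollification of `u`, whose gradient has `L¹` norm at most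
the total variation. The constant does not depend on `N`, so the bound reaches every frequency. The
factor `4^{k+2}` undoes the square of the kernel coefficients, and `Λ^k` compares `supNorm m` with
`|ξ_m|`. -/
theorem sum_low_le_critical (k : ℕ) (hk : 1 ≤ k) (Λ : ℝ) (hΛ : 0 < Λ) : ∃ C : ℝ, 0 < C ∧
    ∀ (L : Fin (k + 2) → ℝ) [∀ i, Fact (0 < L i)] (ℓ : ℝ), 0 < ℓ → (∀ i, ℓ ≤ L i) →
    (∀ i, L i ≤ Λ * ℓ) → ∀ u : FlatTorus L → ℝ, MemBV L u → coeff L u 0 = 0 → ∀ N : ℕ,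
    vol L * ∑ m ∈ (box (k + 2) N).erase 0, (‖freq L m‖ ^ k)⁻¹ * ‖coeff L u m‖ ^ 2 ≤
      C * tv L u ^ 2 := by
  refine ⟨4 ^ (k + 2) * Λ ^ k *
    (sobolevConst k ^ (1 / ((k : ℝ) + 2)) * (((k : ℝ) + 2) * Λ + 1)) ^ 2 , ?_, ?_⟩
  · have : 0 < sobolevConst k := by unfold sobolevConst; positivity
    positivity
  intro L _ ℓ hℓ hℓL hLΛ u hu hu0 N
  have hV := vol_pos (L := L)
  set N' := max N 1
  obtain ⟨S, κ, K, hK, hK0, hKA, hK1, hκ0, hκ⟩ := exists_fejer_kernel L (N := N') (le_max_right _ _)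
  have hφ := hK.trig_mollify hu.1
  have hφ0 : ∫ x, mollify K u x = 0 := by
    have := hφ.integral_eq
    rw [hu0] at this
    simpa using this
  have h1 := hφ.sum_le_critical hk hφ0 hℓ hℓL hLΛ (integral_norm_grad_mollify_le hu hK hK0 hK1)
  have h2 : ∑ m ∈ (box (k + 2) N).erase 0, (‖freq L m‖ ^ k)⁻¹ * ‖coeff L u m‖ ^ 2 ≤
      4 ^ (k + 2) * (Λ * ℓ) ^ k *
        ∑ m ∈ S.erase 0, ((supNorm m : ℝ) ^ k)⁻¹ * ‖(κ m : ℂ) * coeff L u m‖ ^ 2 := by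
    rw [Finset.mul_sum]
    have hmem : ∀ m ∈ (box (k + 2) N).erase 0, m ∈ S ∧ ((2 : ℝ) ^ (k + 2))⁻¹ ≤ κ m := by
      intro m hm
      exact hκ m (supNorm_le_iff.1
        ((mem_box.1 (Finset.mem_of_mem_erase hm)).trans (le_max_left _ _)))
    calc ∑ m ∈ (box (k + 2) N).erase 0, (‖freq L m‖ ^ k)⁻¹ * ‖coeff L u m‖ ^ 2
        ≤ ∑ m ∈ (box (k + 2) N).erase 0, 4 ^ (k + 2) * (Λ * ℓ) ^ k *
            (((supNorm m : ℝ) ^ k)⁻¹ * ‖(κ m : ℂ) * coeff L u m‖ ^ 2) := by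
          refine Finset.sum_le_sum fun m hm => ?_
          have hm0 := supNorm_pos (Finset.ne_of_mem_erase hm)
          have hκm := (hmem m hm).2
          have h3 := supNorm_le_norm_freq hLΛ m
          have h4 : (0 : ℝ) < supNorm m := by exact_mod_cast hm0
          have h5 : (‖freq L m‖ ^ k)⁻¹ ≤ (Λ * ℓ) ^ k * ((supNorm m : ℝ) ^ k)⁻¹ := by
            rw [← div_eq_mul_inv, ← div_pow, ← inv_pow, ← inv_div]
            gcongr
          have h6 : (1 : ℝ) ≤ 4 ^ (k + 2) * κ m ^ 2 := by
            have h7 : (1 : ℝ) ≤ 2 ^ (k + 2) * κ m := by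
              rwa [inv_le_iff_one_le_mul₀' (by positivity)] at hκm
            calc (1 : ℝ) ≤ (2 ^ (k + 2) * κ m) ^ 2 := one_le_pow₀ h7
              _ = _ := by
                rw [mul_pow, ← pow_mul, mul_comm (k + 2) 2, pow_mul]
                norm_num
          rw [norm_mul, Complex.norm_real, Real.norm_of_nonneg (hκ0 m)]
          calc (‖freq L m‖ ^ k)⁻¹ * ‖coeff L u m‖ ^ 2
              ≤ ((Λ * ℓ) ^ k * ((supNorm m : ℝ) ^ k)⁻¹) * ‖coeff L u m‖ ^ 2 * 1 := by
                rw [mul_one]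
                gcongr
            _ ≤ ((Λ * ℓ) ^ k * ((supNorm m : ℝ) ^ k)⁻¹) * ‖coeff L u m‖ ^ 2 *
                (4 ^ (k + 2) * κ m ^ 2) := by gcongr
            _ = _ := by ring
      _ ≤ _ := by
          refine Finset.sum_le_sum_of_subset_of_nonneg (fun m hm => ?_) fun m _ _ => by positivity
          exact Finset.mem_erase.2 ⟨Finset.ne_of_mem_erase hm, (hmem m hm).1⟩
  calc vol L * ∑ m ∈ (box (k + 2) N).erase 0, (‖freq L m‖ ^ k)⁻¹ * ‖coeff L u m‖ ^ 2
      ≤ vol L * (4 ^ (k + 2) * (Λ * ℓ) ^ k *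
        ∑ m ∈ S.erase 0, ((supNorm m : ℝ) ^ k)⁻¹ * ‖(κ m : ℂ) * coeff L u m‖ ^ 2) := by gcongr
    _ = 4 ^ (k + 2) * Λ ^ k * (ℓ ^ k * vol L *
        ∑ m ∈ S.erase 0, ((supNorm m : ℝ) ^ k)⁻¹ * ‖(κ m : ℂ) * coeff L u m‖ ^ 2) := by
        rw [mul_pow]; ring
    _ ≤ 4 ^ (k + 2) * Λ ^ k * (sobolevConst k ^ (1 / ((k : ℝ) + 2)) *
        (((k : ℝ) + 2) * Λ + 1) * tv L u) ^ 2 := by gcongr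
    _ = _ := by ring

end

/-! ### Energy of the high and of the low frequencies. -/

section

/-- Dyadic decomposition: the shell between `2^i N` and `2^{i+1} N` has at most `(5 · 2^i N)^n`
points, leaving a geometric series of ratio `2^{-b}`. This is where `b > 0` is indispensable. -/
theorem sum_rpow_supNorm_le (n : ℕ) {b : ℝ} (hb : 0 < b) {N : ℕ} (hN : 1 ≤ N)
    {F : Finset (Fin n → ℤ)} (hF : ∀ m ∈ F, N ≤ supNorm m) :
    ∑ m ∈ F, (supNorm m : ℝ) ^ (-(n + b)) ≤
      5 ^ n * (1 - (2 : ℝ) ^ (-b))⁻¹ * (N : ℝ) ^ (-b) := by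
  have hx1 : (2 : ℝ) ^ (-b) < 1 := Real.rpow_lt_one_of_one_lt_of_neg one_lt_two (by linarith)
  have hx0 : 0 ≤ (2 : ℝ) ^ (-b) := by positivity
  have hN0 : (0 : ℝ) < N := by exact_mod_cast hN
  set I := F.sup supNorm + 1
  let g : ℕ → (Fin n → ℤ) → ℝ := fun i m =>
    if m ∈ box n (2 ^ (i + 1) * N) then ((2 : ℝ) ^ i * N) ^ (-(n + b)) else 0
  have hg0 : ∀ i m, 0 ≤ g i m := fun i m => by
    simp only [g]
    split_ifs <;> positivity
  have h1 : ∀ m ∈ F, (supNorm m : ℝ) ^ (-(n + b)) ≤ ∑ i ∈ Finset.range I, g i m := by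
    intro m hm
    set i := Nat.log 2 (supNorm m / N)
    have hdiv : supNorm m / N ≠ 0 := (Nat.div_pos (hF m hm) hN).ne'
    have h2 : 2 ^ i * N ≤ supNorm m := (Nat.le_div_iff_mul_le hN).1 (Nat.pow_log_le_self 2 hdiv)
    have h3 : supNorm m < 2 ^ (i + 1) * N :=
      (Nat.div_lt_iff_lt_mul hN).1 (Nat.lt_pow_succ_log_self one_lt_two _)
    have h4 : i < I := by
      have h5 : i ≤ supNorm m := (Nat.log_le_self _ _).trans (Nat.div_le_self _ _)
      have h6 : supNorm m ≤ F.sup supNorm := Finset.le_sup hm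
      omega
    calc (supNorm m : ℝ) ^ (-(n + b)) ≤ g i m := by
          simp only [g]
          rw [if_pos (mem_box.2 h3.le)]
          refine Real.rpow_le_rpow_of_nonpos (by positivity) (by exact_mod_cast h2) ?_
          have : (0 : ℝ) ≤ n := n.cast_nonneg
          linarith
      _ ≤ _ := Finset.single_le_sum (f := fun i => g i m) (fun i _ => hg0 i m) (Finset.mem_range.2 h4)
  have h7 : ∀ i, ∑ m ∈ F, g i m ≤ 5 ^ n * (N : ℝ) ^ (-b) * ((2 : ℝ) ^ (-b)) ^ i := by
    intro i
    have hy : (1 : ℝ) ≤ 2 ^ i * N := by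
      have : 1 ≤ 2 ^ i * N := Nat.one_le_iff_ne_zero.2 (by positivity)
      exact_mod_cast this
    simp only [g, ← Finset.sum_filter, Finset.sum_const, nsmul_eq_mul]
    have h8 : (((F.filter fun m => m ∈ box n (2 ^ (i + 1) * N)).card : ℕ) : ℝ) ≤
        (5 * (2 ^ i * N)) ^ n := by
      calc (((F.filter fun m => m ∈ box n (2 ^ (i + 1) * N)).card : ℕ) : ℝ)
          ≤ ((box n (2 ^ (i + 1) * N)).card : ℝ) := by
            exact_mod_cast Finset.card_le_card fun m hm => (Finset.mem_filter.1 hm).2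
        _ = (4 * (2 ^ i * N) + 1 : ℝ) ^ n := by
            rw [card_box]
            push_cast
            ring
        _ ≤ _ := by
            gcongr
            linarith
    calc (((F.filter fun m => m ∈ box n (2 ^ (i + 1) * N)).card : ℕ) : ℝ) *
          ((2 : ℝ) ^ i * N) ^ (-(n + b))
        ≤ (5 * (2 ^ i * N)) ^ n * ((2 : ℝ) ^ i * N) ^ (-(n + b)) := by gcongr
      _ = 5 ^ n * ((2 : ℝ) ^ i * N) ^ (-b) := by
          rw [mul_pow, mul_assoc, ← Real.rpow_natCast (2 ^ i * (N : ℝ)) n,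
            ← Real.rpow_add (by positivity)]
          congr 2
          ring
      _ = _ := by
          rw [Real.mul_rpow (by positivity) hN0.le, ← Real.rpow_natCast 2 i, ← Real.rpow_mul (by norm_num),
            ← Real.rpow_natCast ((2 : ℝ) ^ (-b)) i, ← Real.rpow_mul (by norm_num), mul_comm (i : ℝ)]
          ring
  calc ∑ m ∈ F, (supNorm m : ℝ) ^ (-(n + b))
      ≤ ∑ m ∈ F, ∑ i ∈ Finset.range I, g i m := Finset.sum_le_sum h1
    _ = ∑ i ∈ Finset.range I, ∑ m ∈ F, g i m := Finset.sum_comm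
    _ ≤ ∑ i ∈ Finset.range I, 5 ^ n * (N : ℝ) ^ (-b) * ((2 : ℝ) ^ (-b)) ^ i :=
        Finset.sum_le_sum fun i _ => h7 i
    _ = 5 ^ n * (N : ℝ) ^ (-b) * ∑ i ∈ Finset.range I, ((2 : ℝ) ^ (-b)) ^ i := by
        rw [Finset.mul_sum]
    _ ≤ 5 ^ n * (N : ℝ) ^ (-b) * (1 - (2 : ℝ) ^ (-b))⁻¹ := by
        gcongr
        rw [← tsum_geometric_of_lt_one hx0 hx1]
        exact (summable_geometric_of_lt_one hx0 hx1).sum_le_tsum _ fun i _ => by positivity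
    _ = _ := by ring

variable {n : ℕ} {L : Fin n → ℝ} {u : FlatTorus L → ℝ}

theorem pow_le_vol {ℓ : ℝ} (hℓ : 0 < ℓ) (hℓL : ∀ i, ℓ ≤ L i) : ℓ ^ n ≤ vol L := by
  calc ℓ ^ n = ∏ _i : Fin n, ℓ := by simp
    _ ≤ _ := Finset.prod_le_prod (fun _ _ => hℓ.le) fun i _ => hℓL i

variable [∀ i, Fact (0 < L i)]

variable (L) in
/-- The contribution of the frequencies in `F` to the square of the norm of order `-s`. -/
def partialEnergy (s : ℝ) (u : FlatTorus L → ℝ) (F : Finset (Fin n → ℤ)) : ℝ :=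
  vol L * ∑ m ∈ F, ‖freq L m‖ ^ (2 * -s) * ‖coeff L u m‖ ^ 2

/-- The coefficient decay of `norm_coeff_le` turns the energy into a sum of `|ξ_m|^{-(2s+2)} =
|ξ_m|^{-(n+b)}`, and the lattice tail is summable. -/
theorem partialEnergy_high_le (hu : MemBV L u) {s b : ℝ} (hb : 0 < b)
    (hsb : 2 * s + 2 = n + b) {ℓ Λ : ℝ} (hℓ : 0 < ℓ) (hΛ : 0 < Λ) (hℓL : ∀ i, ℓ ≤ L i)
    (hLΛ : ∀ i, L i ≤ Λ * ℓ) {N : ℕ} (hN : 1 ≤ N) {F : Finset (Fin n → ℤ)}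
    (hF : ∀ m ∈ F, N ≤ supNorm m) :
    partialEnergy L s u F ≤
      Λ ^ ((n : ℝ) + b) * (5 ^ n * (1 - (2 : ℝ) ^ (-b))⁻¹) * (tv L u ^ 2 * (ℓ / N) ^ b) := by
  have hV := vol_pos (L := L)
  have hT := tv_nonneg (u := u)
  have hN0 : (0 : ℝ) < N := by exact_mod_cast hN
  have hnb : 0 < (n : ℝ) + b := by positivity
  have h1 : ∀ m ∈ F, vol L * (‖freq L m‖ ^ (2 * -s) * ‖coeff L u m‖ ^ 2) ≤
      tv L u ^ 2 * ((ℓ ^ n)⁻¹ * (Λ * ℓ) ^ ((n : ℝ) + b)) * (supNorm m : ℝ) ^ (-(n + b)) := by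
    intro m hm
    have hsn : 0 < supNorm m := hN.trans (hF m hm)
    have hm0 : m ≠ 0 := fun h => by simp [supNorm_eq_zero_iff.2 h] at hsn
    have hsn' : (0 : ℝ) < supNorm m := by exact_mod_cast hsn
    have hξ := norm_freq_pos L hm0
    have h2 : vol L * ‖coeff L u m‖ ≤ tv L u * ‖freq L m‖⁻¹ := by
      rw [← div_eq_mul_inv, le_div_iff₀ hξ]
      have h3 := norm_coeff_le hu hm0
      have h4 : 0 ≤ vol L * ‖coeff L u m‖ * ‖freq L m‖ := by positivity
      nlinarith [Real.pi_gt_three]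
    have h5 : ‖freq L m‖ ^ (-((n : ℝ) + b)) ≤ (Λ * ℓ) ^ ((n : ℝ) + b) *
        (supNorm m : ℝ) ^ (-(n + b)) := by
      calc ‖freq L m‖ ^ (-((n : ℝ) + b)) ≤ (supNorm m / (Λ * ℓ)) ^ (-((n : ℝ) + b)) :=
            Real.rpow_le_rpow_of_nonpos (by positivity) (supNorm_le_norm_freq hLΛ m) (by linarith)
        _ = _ := by
            rw [Real.div_rpow hsn'.le (by positivity), Real.rpow_neg (by positivity : 0 ≤ Λ * ℓ),
              div_inv_eq_mul, mul_comm]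
    calc vol L * (‖freq L m‖ ^ (2 * -s) * ‖coeff L u m‖ ^ 2)
        = (vol L)⁻¹ * ‖freq L m‖ ^ (2 * -s) * (vol L * ‖coeff L u m‖) ^ 2 := by
          field_simp
      _ ≤ (ℓ ^ n)⁻¹ * ‖freq L m‖ ^ (2 * -s) * (tv L u * ‖freq L m‖⁻¹) ^ 2 := by
          gcongr
          exact pow_le_vol hℓ hℓL
      _ = tv L u ^ 2 * (ℓ ^ n)⁻¹ * ‖freq L m‖ ^ (-((n : ℝ) + b)) := by
          have : ‖freq L m‖ ^ (-((n : ℝ) + b)) = ‖freq L m‖ ^ (2 * -s) * (‖freq L m‖⁻¹) ^ 2 := by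
            rw [← Real.rpow_natCast _ 2, ← Real.rpow_neg_one, ← Real.rpow_mul hξ.le,
              ← Real.rpow_add hξ]
            congr 1
            push_cast
            linarith
          rw [this]
          ring
      _ ≤ tv L u ^ 2 * (ℓ ^ n)⁻¹ * ((Λ * ℓ) ^ ((n : ℝ) + b) * (supNorm m : ℝ) ^ (-(n + b))) := by
          gcongr
      _ = _ := by ring
  rw [partialEnergy, Finset.mul_sum]
  refine (Finset.sum_le_sum h1).trans ?_
  rw [← Finset.mul_sum]
  refine (mul_le_mul_of_nonneg_left (sum_rpow_supNorm_le n hb hN hF) (by positivity)).trans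
    (le_of_eq ?_)
  rw [Real.mul_rpow hΛ.le hℓ.le, Real.rpow_add hℓ, Real.rpow_natCast, Real.div_rpow hℓ.le hN0.le,
    Real.rpow_neg hN0.le]
  field_simp

/-- `sum_low_le` with the powers of `2π` separated out and the volume bounded below by `ℓ^n`. -/
theorem partialEnergy_low_le (hu : MemBV L u) (hu0 : coeff L u 0 = 0) {s : ℝ} {p : ℝ≥0∞}
    (hp : 1 ≤ p) (hW : wdotNegNorm L p (fracLaplacian L (-s) (coeff L u)) ≠ ∞)
    {ℓ : ℝ} (hℓ : 0 < ℓ) (hℓL : ∀ i, ℓ ≤ L i) {N : ℕ} (hN : 1 ≤ N)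
    {F : Finset (Fin n → ℤ)} (hF0 : 0 ∉ F) (hF : F ⊆ box n N) :
    partialEnergy L s u F ≤ ((2 * Real.pi) ^ (2 * s) * 2 ^ n * 2 ^ (n * (p⁻¹).toReal)) *
      (tv L u * (wdotNegNorm L p (fracLaplacian L (-s) (coeff L u))).toReal *
        (N / ℓ) ^ (n * (p⁻¹).toReal)) := by
  have hV := vol_pos (L := L)
  have hT := tv_nonneg (u := u)
  have h1 := sum_low_le hu hu0 hp hW hN (F := F) fun m hm =>
    ⟨fun h => hF0 (h ▸ hm), supNorm_le_iff.1 (mem_box.1 (hF hm))⟩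
  set W := (wdotNegNorm L p (fracLaplacian L (-s) (coeff L u))).toReal
  set α := (p⁻¹).toReal
  have hα : 0 ≤ α := ENNReal.toReal_nonneg
  have hW0 : 0 ≤ W := ENNReal.toReal_nonneg
  have h2 : partialEnergy L s u F = (2 * Real.pi) ^ (2 * s) * (vol L *
      ∑ m ∈ F, (2 * Real.pi * ‖freq L m‖) ^ (2 * -s) * ‖coeff L u m‖ ^ 2) := by
    rw [partialEnergy, mul_left_comm ((2 * Real.pi) ^ (2 * s))]
    congr 1
    rw [Finset.mul_sum]
    refine Finset.sum_congr rfl fun m _ => ?_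
    rw [Real.mul_rpow (by positivity) (norm_nonneg _), ← mul_assoc, ← mul_assoc,
      ← Real.rpow_add (by positivity)]
    simp
  have h3 : ((2 * N : ℝ) ^ n / vol L) ^ α ≤ 2 ^ (n * α) * (N / ℓ) ^ (n * α) := by
    calc ((2 * N : ℝ) ^ n / vol L) ^ α ≤ ((2 * N : ℝ) ^ n / ℓ ^ n) ^ α := by
          gcongr
          exact pow_le_vol hℓ hℓL
      _ = _ := by
          rw [← div_pow, ← Real.rpow_natCast, ← Real.rpow_mul (by positivity), mul_div_assoc,
            Real.mul_rpow (by norm_num) (by positivity)]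
  rw [h2]
  calc (2 * Real.pi) ^ (2 * s) * (vol L *
        ∑ m ∈ F, (2 * Real.pi * ‖freq L m‖) ^ (2 * -s) * ‖coeff L u m‖ ^ 2)
      ≤ (2 * Real.pi) ^ (2 * s) * (2 ^ n * (tv L u * ((2 * N : ℝ) ^ n / vol L) ^ α * W)) := by
        gcongr
    _ ≤ (2 * Real.pi) ^ (2 * s) * (2 ^ n * (tv L u * (2 ^ (n * α) * (N / ℓ) ^ (n * α)) * W)) := by
        gcongr
    _ = _ := by ring

end

/-! ### Optimization and the two regimes of the balance. -/

/-- Optimization of the splitting frequency. -/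
theorem le_of_forall_split {a b θ : ℝ} (ha : 0 ≤ a) (hb : 0 < b) (hθ : θ < 1)
    (hab : 2 * (1 - θ) * (a + b) = b) {A B X T W ℓ : ℝ} (hA : 0 ≤ A) (hB : 0 ≤ B) (hT : 0 < T)
    (hW : 0 ≤ W) (hℓ : 0 < ℓ) (h1 : X ≤ B * (T ^ 2 * ℓ ^ b))
    (h2 : ∀ N : ℕ, 1 ≤ N → X ≤ A * (T * W * (N / ℓ) ^ a) + B * (T ^ 2 * (ℓ / N) ^ b)) :
    X ≤ (A + 2 ^ b * B) * (W ^ (2 * (1 - θ)) * T ^ (2 * θ)) := by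
  have h2b : (1 : ℝ) ≤ 2 ^ b := Real.one_le_rpow one_le_two hb.le
  rcases hW.eq_or_lt with hW0 | hW0
  -- With `W = 0` the low part costs nothing, and letting `N` tend to infinity removes the high
  -- part.
  · rw [← hW0, Real.zero_rpow (by linarith), zero_mul, mul_zero]
    have hlim : Filter.Tendsto (fun N : ℕ => B * (T ^ 2 * (ℓ / (N : ℝ)) ^ b)) Filter.atTop
        (nhds (B * (T ^ 2 * 0 ^ b))) := by
      refine Filter.Tendsto.const_mul _ (Filter.Tendsto.const_mul _ ?_)
      exact (tendsto_const_div_atTop_nhds_zero_nat ℓ).rpow_const (Or.inr hb.le)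
    rw [Real.zero_rpow hb.ne', mul_zero, mul_zero] at hlim
    refine ge_of_tendsto hlim (Filter.eventually_atTop.2 ⟨1, fun N hN => ?_⟩)
    have := h2 N hN
    rwa [← hW0, mul_zero, zero_mul, mul_zero, zero_add] at this
  · have hab0 : 0 < a + b := by linarith
    -- The value of `N/ℓ` at which the two bounds coincide.
    set ρ := (T / W) ^ (1 / (a + b)) with hρ
    have hρ0 : 0 < ρ := by positivity
    have hρW : T * W * ρ ^ a = T ^ 2 * ρ ^ (-b) := by
      have h3 : ρ ^ (a + b) = T / W := by
        rw [hρ, ← Real.rpow_mul (by positivity), one_div_mul_cancel hab0.ne', Real.rpow_one]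
      have h4 : ρ ^ a = ρ ^ (a + b) * ρ ^ (-b) := by
        rw [← Real.rpow_add hρ0]
        congr 1
        ring
      rw [h4, h3]
      field_simp
    have hρb : T ^ 2 * ρ ^ (-b) = W ^ (2 * (1 - θ)) * T ^ (2 * θ) := by
      rw [hρ, ← Real.rpow_mul (by positivity)]
      have h3 : 1 / (a + b) * -b = -(2 * (1 - θ)) := by
        field_simp
        linarith
      rw [h3, Real.rpow_neg (by positivity), ← Real.inv_rpow (by positivity), inv_div,
        Real.div_rpow hW0.le hT.le, ← Real.rpow_natCast T 2]
      have h4 : T ^ ((2 : ℕ) : ℝ) = T ^ (2 * θ) * T ^ (2 * (1 - θ)) := by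
        rw [← Real.rpow_add hT]
        congr 1
        push_cast
        ring
      rw [h4]
      field_simp
    rw [← hρb]
    have hP : 0 ≤ T ^ 2 * ρ ^ (-b) := by positivity
    -- If the ideal cut-off lies below the first frequency, all frequencies count as high. Otherwise
    -- the cut-off is rounded down to an integer, losing at most a factor `2` and hence `2^b` in the
    -- high part.
    rcases lt_or_ge (ρ * ℓ) 1 with hlt | hge
    · have h5 : ℓ ^ b ≤ ρ ^ (-b) := by
        rw [Real.rpow_neg hρ0.le, ← Real.inv_rpow hρ0.le]
        gcongr
        rw [← one_div, le_div_iff₀' hρ0]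
        exact hlt.le
      calc X ≤ B * (T ^ 2 * ℓ ^ b) := h1
        _ ≤ 1 * B * (T ^ 2 * ρ ^ (-b)) := by rw [one_mul]; gcongr
        _ ≤ (A + 2 ^ b * B) * (T ^ 2 * ρ ^ (-b)) := by
            gcongr
            nlinarith
    · set N := ⌊ρ * ℓ⌋₊
      have hN1 : 1 ≤ N := Nat.one_le_floor_iff _ |>.2 hge
      have hN0 : (0 : ℝ) < N := by exact_mod_cast hN1
      have hNle : (N : ℝ) ≤ ρ * ℓ := Nat.floor_le (by positivity)
      have hNge : ρ * ℓ ≤ 2 * N := by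
        have h6 := Nat.lt_floor_add_one (ρ * ℓ)
        have h7 : (1 : ℝ) ≤ N := by exact_mod_cast hN1
        linarith
      calc X ≤ A * (T * W * (N / ℓ) ^ a) + B * (T ^ 2 * (ℓ / N) ^ b) := h2 N hN1
        _ ≤ A * (T * W * ρ ^ a) + B * (T ^ 2 * (2 ^ b * ρ ^ (-b))) := by
            gcongr
            · rwa [div_le_iff₀ hℓ]
            · rw [Real.rpow_neg hρ0.le, ← div_eq_mul_inv, ← Real.div_rpow (by norm_num) hρ0.le]
              gcongr 1
              rw [div_le_div_iff₀ hN0 hρ0]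
              linarith
        _ = _ := by rw [hρW]; ring

/-- The case `b > 0`: split at `N` and optimize. Vanishing total variation is set apart, because the
optimal cut-off would degenerate; there the high-frequency bound alone kills the energy. -/
theorem exists_partialEnergy_le_subcritical {n : ℕ} {s θ b Λ : ℝ} {p : ℝ≥0∞} (hb : 0 < b)
    (hsb : 2 * s + 2 = n + b) (hΛ : 0 < Λ) (hp : 1 ≤ p) (hθ1 : θ < 1)
    (hab : 2 * (1 - θ) * (n * (p⁻¹).toReal + b) = b) :
    ∃ C : ℝ, 0 < C ∧ ∀ (L : Fin n → ℝ) [∀ i, Fact (0 < L i)] (ℓ : ℝ), 0 < ℓ → (∀ i, ℓ ≤ L i) →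
      (∀ i, L i ≤ Λ * ℓ) → ∀ u : FlatTorus L → ℝ, MemBV L u → coeff L u 0 = 0 →
      wdotNegNorm L p (fracLaplacian L (-s) (coeff L u)) ≠ ∞ →
      ∀ F : Finset (Fin n → ℤ), 0 ∉ F → partialEnergy L s u F ≤
        C * ((wdotNegNorm L p (fracLaplacian L (-s) (coeff L u))).toReal ^ (2 * (1 - θ)) *
          tv L u ^ (2 * θ)) := by
  set A : ℝ := (2 * Real.pi) ^ (2 * s) * 2 ^ n * 2 ^ (n * (p⁻¹).toReal)
  set B : ℝ := Λ ^ ((n : ℝ) + b) * (5 ^ n * (1 - (2 : ℝ) ^ (-b))⁻¹)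
  have hA : 0 < A := by positivity
  have hB : 0 < B := by
    have hx1 : (2 : ℝ) ^ (-b) < 1 := Real.rpow_lt_one_of_one_lt_of_neg one_lt_two (by linarith)
    have : 0 < 1 - (2 : ℝ) ^ (-b) := by linarith
    positivity
  refine ⟨A + 2 ^ b * B, by positivity, ?_⟩
  intro L _ ℓ hℓ hℓL hLΛ u hu hu0 hW F hF
  have h1 : partialEnergy L s u F ≤ B * (tv L u ^ 2 * ℓ ^ b) := by
    have := partialEnergy_high_le hu hb hsb hℓ hΛ hℓL hLΛ le_rfl (F := F) fun m hm =>
      supNorm_pos fun h => hF (h ▸ hm)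
    simpa using this
  rcases (tv_nonneg (u := u)).eq_or_lt with hT | hT
  · rw [← hT] at h1
    refine (h1.trans (le_of_eq ?_)).trans (by positivity : (0 : ℝ) ≤ _)
    ring
  refine le_of_forall_split (by positivity) hb hθ1 hab hA.le hB.le hT ENNReal.toReal_nonneg hℓ h1
    fun N hN => ?_
  have hsplit : partialEnergy L s u F = partialEnergy L s u (F.filter fun m => supNorm m ≤ N) +
      partialEnergy L s u (F.filter fun m => ¬ supNorm m ≤ N) := by
    simp only [partialEnergy]
    rw [← mul_add, Finset.sum_filter_add_sum_filter_not]
  rw [hsplit]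
  refine add_le_add ?_ ?_
  · exact partialEnergy_low_le hu hu0 hp hW hℓ hℓL hN (fun h => hF (Finset.mem_filter.1 h).1)
      fun m hm => mem_box.2 (Finset.mem_filter.1 hm).2
  · exact partialEnergy_high_le hu hb hsb hℓ hΛ hℓL hLΛ hN fun m hm =>
      (not_le.1 (Finset.mem_filter.1 hm).2).le

/-- The case `b = 0`. The bound `X ≤ B T²` is always available. If `θ < 1`, then `1/p = 0`, so the
low-frequency bound is independent of `N` and gives `X ≤ A T W` for all frequencies. The result is
the product `X = X^{2(1-θ)} X^{2θ-1}`, where `θ ≥ 1/2` keeps the second exponent nonnegative. For `θ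
= 1` the first factor is `1`, and finiteness of the dual norm is not needed. -/
theorem exists_partialEnergy_le_critical {n : ℕ} {s θ Λ : ℝ} {p : ℝ≥0∞}
    (hs : 0 < s) (hsn : 2 * s + 2 = n) (hΛ : 0 < Λ) (hp : 1 ≤ p) (hθ0 : 1 / 2 ≤ θ)
    (hα : (1 - θ) * (p⁻¹).toReal = 0) :
    ∃ C : ℝ, 0 < C ∧ ∀ (L : Fin n → ℝ) [∀ i, Fact (0 < L i)] (ℓ : ℝ), 0 < ℓ → (∀ i, ℓ ≤ L i) →
      (∀ i, L i ≤ Λ * ℓ) → ∀ u : FlatTorus L → ℝ, MemBV L u → coeff L u 0 = 0 →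
      (θ < 1 → wdotNegNorm L p (fracLaplacian L (-s) (coeff L u)) ≠ ∞) → θ ≤ 1 →
      ∀ F : Finset (Fin n → ℤ), 0 ∉ F → partialEnergy L s u F ≤
        C * ((wdotNegNorm L p (fracLaplacian L (-s) (coeff L u))).toReal ^ (2 * (1 - θ)) *
          tv L u ^ (2 * θ)) := by
  have hn : 2 < n := by
    have : (2 : ℝ) < n := by linarith
    exact_mod_cast this
  obtain ⟨k, rfl⟩ : ∃ k, n = k + 2 := ⟨n - 2, by omega⟩
  have hk : 1 ≤ k := by omega
  have hsk : 2 * s = k := by push_cast at hsn; linarith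
  obtain ⟨B, hB, hcrit⟩ := sum_low_le_critical k hk Λ hΛ
  set A : ℝ := (2 * Real.pi) ^ (2 * s) * 2 ^ (k + 2) * 2 ^ (((k + 2 : ℕ) : ℝ) * (p⁻¹).toReal)
  have hA : 0 < A := by positivity
  refine ⟨A ^ (2 * (1 - θ)) * B ^ (2 * θ - 1), by positivity, ?_⟩
  intro L _ ℓ hℓ hℓL hLΛ u hu hu0 hW hθ1 F hF
  have hT := tv_nonneg (u := u)
  set X := partialEnergy L s u F
  set W := (wdotNegNorm L p (fracLaplacian L (-s) (coeff L u))).toReal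
  have hW0 : 0 ≤ W := ENNReal.toReal_nonneg
  have hX0 : 0 ≤ X := mul_nonneg vol_pos.le (Finset.sum_nonneg fun m _ => by positivity)
  obtain ⟨N, hN⟩ := exists_subset_box F
  have h1 : X ≤ B * tv L u ^ 2 := by
    refine le_trans ?_ (hcrit L ℓ hℓ hℓL hLΛ u hu hu0 N)
    have h2 : ∀ m : Fin (k + 2) → ℤ, ‖freq L m‖ ^ (2 * -s) = (‖freq L m‖ ^ k)⁻¹ := by
      intro m
      rw [mul_neg, hsk, Real.rpow_neg (norm_nonneg _), Real.rpow_natCast]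
    simp only [X, partialEnergy, h2]
    refine mul_le_mul_of_nonneg_left ?_ vol_pos.le
    refine Finset.sum_le_sum_of_subset_of_nonneg (fun m hm => ?_) fun m _ _ => by positivity
    exact Finset.mem_erase.2 ⟨fun h => hF (h ▸ hm), hN hm⟩
  have h2 : X ^ (2 * (1 - θ)) ≤ (A * (tv L u * W)) ^ (2 * (1 - θ)) := by
    rcases hθ1.eq_or_lt with rfl | hθ
    · simp
    · have hα0 : (p⁻¹).toReal = 0 := by
        rcases mul_eq_zero.1 hα with h | h
        · linarith
        · exact h
      have h3 := partialEnergy_low_le hu hu0 hp (hW hθ) hℓ hℓL (le_max_right N 1) hF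
        (hN.trans fun m hm => mem_box.2 ((mem_box.1 hm).trans (le_max_left N 1)))
      simp only [A, X, W]
      rw [hα0] at h3 ⊢
      rw [mul_zero, Real.rpow_zero, Real.rpow_zero, mul_one, mul_one] at *
      have : (0 : ℝ) ≤ 2 * (1 - θ) := by linarith
      exact Real.rpow_le_rpow hX0 h3 this
  have h4 : X ^ (2 * θ - 1) ≤ (B * tv L u ^ 2) ^ (2 * θ - 1) :=
    Real.rpow_le_rpow hX0 h1 (by linarith)
  calc X = X ^ (2 * (1 - θ)) * X ^ (2 * θ - 1) := by
        rw [← Real.rpow_add' hX0 (by ring_nf; norm_num)]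
        ring_nf
        simp
    _ ≤ (A * (tv L u * W)) ^ (2 * (1 - θ)) * (B * tv L u ^ 2) ^ (2 * θ - 1) := by gcongr
    _ = _ := by
      rw [Real.mul_rpow hA.le (by positivity), Real.mul_rpow hT hW0, Real.mul_rpow hB.le (by positivity),
        ← Real.rpow_natCast (tv L u) 2, ← Real.rpow_mul hT]
      have h5 : tv L u ^ (2 * θ) = tv L u ^ (2 * (1 - θ)) * tv L u ^ (((2 : ℕ) : ℝ) * (2 * θ - 1)) := by
        rw [← Real.rpow_add_of_nonneg hT (by linarith) (by push_cast; linarith)]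
        congr 1
        push_cast
        ring
      rw [h5]
      ring

theorem coeff_eq_zero_of_tv_eq_zero {n : ℕ} {L : Fin n → ℝ} [∀ i, Fact (0 < L i)]
    {u : FlatTorus L → ℝ} (hu : MemBV L u) (hT : tv L u = 0) {m : Fin n → ℤ} (hm : m ≠ 0) :
    coeff L u m = 0 := by
  have h := norm_coeff_le hu hm
  rw [hT] at h
  have h1 := norm_freq_pos L hm
  have h2 := vol_pos (L := L)
  by_contra h0
  have h3 : 0 < ‖coeff L u m‖ := norm_pos_iff.2 h0
  have : 0 < 2 * Real.pi * ‖freq L m‖ * (vol L * ‖coeff L u m‖) := by positivity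
  linarith

theorem hdotNorm_le_of_partialEnergy_le {n : ℕ} {L : Fin n → ℝ} [∀ i, Fact (0 < L i)]
    {u : FlatTorus L → ℝ} {s D : ℝ}
    (h : ∀ F : Finset (Fin n → ℤ), 0 ∉ F → partialEnergy L s u F ≤ D) :
    hdotNorm L (-s) (coeff L u) ≤ ENNReal.ofReal D ^ (1 / 2 : ℝ) := by
  classical
  unfold hdotNorm
  gcongr
  rw [← ENNReal.tsum_mul_left, ENNReal.tsum_eq_iSup_sum]
  refine iSup_le fun G => ?_
  have h1 := h (G.map (Function.Embedding.subtype _)) (by simp)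
  rw [partialEnergy, Finset.sum_map, Finset.mul_sum] at h1
  refine le_trans (le_of_eq ?_) (ENNReal.ofReal_le_ofReal h1)
  rw [ENNReal.ofReal_sum_of_nonneg fun m _ => mul_nonneg vol_pos.le (by positivity)]
  refine Finset.sum_congr rfl fun m _ => ?_
  rw [ENNReal.ofReal_mul vol_pos.le]
  rfl

end FlatTorus

end

/-! ### Assembly: uniformity in the dilation and degenerate values of the norms. -/

theorem mainTheorem4 (n : ℕ) (ω : Fin n → ℝ) (s θ : ℝ) (p : ℝ≥0∞)
    (hω : ∀ i, 0 < ω i) (hn : 1 ≤ n) (hns : (n : ℝ) ≤ 2 * (s + 1))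
    (hs0 : 0 < s) (hs1 : s ≤ 1) (hp : 1 ≤ p) (hθ0 : 1 / 2 ≤ θ) (hθ1 : θ ≤ 1)
    (hbal : s + (n : ℝ) / 2 =
      (1 - θ) * (2 * s + 1 + (n : ℝ) * (p⁻¹).toReal) + θ * ((n : ℝ) - 1)) :
    ∃ C : ℝ≥0, 0 < C ∧
      ∀ (r : ℝ), 0 < r →
      ∀ (L : Fin n → ℝ) [∀ i, Fact (0 < L i)], (∀ i, L i = ω i / r) →
      ∀ u : FlatTorus L → ℝ, FlatTorus.MemBV L u →
        FlatTorus.MemHdot L (-s) (FlatTorus.coeff L u) →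
        FlatTorus.hdotNorm L (-s) (FlatTorus.coeff L u) ≤
          (C : ℝ≥0∞) *
            FlatTorus.wdotNegNorm L p
              (FlatTorus.fracLaplacian L (-s) (FlatTorus.coeff L u)) ^ (1 - θ) *
            FlatTorus.totalVariation L u ^ θ := by
  obtain ⟨i₀, -, hi₀⟩ := Finset.exists_min_image Finset.univ ω ⟨⟨0, hn⟩, Finset.mem_univ _⟩
  have hω₀ := hω i₀
  -- A bound for the ratio of any period to the shortest one; it is unaffected by dividing all
  -- periods by `r`, which is why the constant is uniform in `r`.
  set Λ : ℝ := (∑ i, ω i) / ω i₀ with hΛdef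
  have hsum : ∀ i, ω i ≤ ∑ i, ω i := fun i =>
    Finset.single_le_sum (fun j _ => (hω j).le) (Finset.mem_univ i)
  have hΛ : 0 < Λ := div_pos (hω₀.trans_le (hsum i₀)) hω₀
  -- The scaling balance solved for its `p`-term. It shows that `b > 0` excludes `θ = 1`, and that
  -- `b = 0` forces `θ = 1` or `p = ∞`.
  have hkey : (1 - θ) * (n * (p⁻¹).toReal) = (θ - 1 / 2) * (2 * s + 2 - n) := by
    linear_combination -hbal
  obtain ⟨C, hC, hmain⟩ : ∃ C : ℝ, 0 < C ∧ ∀ (L : Fin n → ℝ) [∀ i, Fact (0 < L i)] (ℓ : ℝ), 0 < ℓ →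
      (∀ i, ℓ ≤ L i) → (∀ i, L i ≤ Λ * ℓ) → ∀ u : FlatTorus L → ℝ, FlatTorus.MemBV L u →
      FlatTorus.coeff L u 0 = 0 →
      (θ < 1 → FlatTorus.wdotNegNorm L p
        (FlatTorus.fracLaplacian L (-s) (FlatTorus.coeff L u)) ≠ ∞) →
      ∀ F : Finset (Fin n → ℤ), 0 ∉ F → FlatTorus.partialEnergy L s u F ≤
        C * ((FlatTorus.wdotNegNorm L p
          (FlatTorus.fracLaplacian L (-s) (FlatTorus.coeff L u))).toReal ^ (2 * (1 - θ)) *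
          FlatTorus.tv L u ^ (2 * θ)) := by
    have hb : 0 ≤ 2 * s + 2 - (n : ℝ) := by linarith
    rcases hb.eq_or_lt with hb | hb
    · have hα : (1 - θ) * (p⁻¹).toReal = 0 := by
        rw [← hb, mul_zero, mul_left_comm] at hkey
        rcases mul_eq_zero.1 hkey with h | h
        · have : n = 0 := by exact_mod_cast h
          omega
        · exact h
      obtain ⟨C, hC, h⟩ := FlatTorus.exists_partialEnergy_le_critical (n := n) hs0 (by linarith) hΛ hp
        hθ0 hα
      exact ⟨C, hC, fun L _ ℓ h1 h2 h3 u h4 h5 h6 => h L ℓ h1 h2 h3 u h4 h5 h6 hθ1⟩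
    · have hθ : θ < 1 := by
        refine lt_of_le_of_ne hθ1 fun h => ?_
        rw [h] at hkey
        linarith
      obtain ⟨C, hC, h⟩ := FlatTorus.exists_partialEnergy_le_subcritical (n := n) (s := s) (θ := θ)
        (p := p) hb (by ring) hΛ hp hθ (by linear_combination 2 * hkey)
      exact ⟨C, hC, fun L _ ℓ h1 h2 h3 u h4 h5 h6 => h L ℓ h1 h2 h3 u h4 h5 (h6 hθ)⟩
  refine ⟨(√C).toNNReal, Real.toNNReal_pos.2 (Real.sqrt_pos.2 hC), ?_⟩
  intro r hr L _ hL u hu huH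
  set W := FlatTorus.wdotNegNorm L p (FlatTorus.fracLaplacian L (-s) (FlatTorus.coeff L u))
  -- This case precedes that of an infinite dual norm: in `ℝ≥0∞` the product `∞ * 0` is `0`, so the
  -- left side itself must be shown to vanish.
  by_cases hT0 : FlatTorus.tv L u = 0
  · have h0 : FlatTorus.hdotNorm L (-s) (FlatTorus.coeff L u) ≤ ENNReal.ofReal 0 ^ (1 / 2 : ℝ) := by
      refine FlatTorus.hdotNorm_le_of_partialEnergy_le fun F hF => le_of_eq ?_
      rw [FlatTorus.partialEnergy, Finset.sum_eq_zero, mul_zero]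
      intro m hm
      rw [FlatTorus.coeff_eq_zero_of_tv_eq_zero hu hT0 fun h => hF (h ▸ hm)]
      simp
    refine h0.trans ?_
    simp
  -- Here the right side is infinite. The case must be removed before passing to reals, since
  -- `toReal` sends `∞` to `0`; for `θ = 1` it is harmless because `∞ ^ 0 = 1`.
  by_cases hW : θ < 1 ∧ W = ∞
  · have hTV : FlatTorus.totalVariation L u ≠ 0 := fun h => hT0 (by simp [FlatTorus.tv, h])
    have h1 : FlatTorus.totalVariation L u ^ θ ≠ 0 := by
      simp [ENNReal.rpow_eq_zero_iff, hTV, hu.2.ne]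
    have h2 : ((√C).toNNReal : ℝ≥0∞) ≠ 0 := by
      rw [ENNReal.coe_ne_zero]
      exact (Real.toNNReal_pos.2 (Real.sqrt_pos.2 hC)).ne'
    rw [hW.2, ENNReal.top_rpow_of_pos (by linarith [hW.1]), ENNReal.mul_top h2, ENNReal.top_mul h1]
    exact le_top
  have hWne : θ < 1 → W ≠ ∞ := fun h h' => hW ⟨h, h'⟩
  have h1 := FlatTorus.hdotNorm_le_of_partialEnergy_le
    (hmain L (ω i₀ / r) (by positivity) (fun i => by
      rw [hL]
      have := hi₀ i (Finset.mem_univ i)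
      gcongr) (fun i => by
      rw [hL, hΛdef, div_mul_div_cancel₀ hω₀.ne']
      have := hsum i
      gcongr) u hu huH.1 hWne)
  refine h1.trans (le_of_eq ?_)
  have hT := FlatTorus.tv_nonneg (L := L) (u := u)
  have hWr : (0 : ℝ) ≤ W.toReal := ENNReal.toReal_nonneg
  have hWW : W ^ (1 - θ) = ENNReal.ofReal (W.toReal ^ (1 - θ)) := by
    rcases hθ1.eq_or_lt with h | h
    · simp [h]
    · rw [← ENNReal.ofReal_rpow_of_nonneg hWr (by linarith), ENNReal.ofReal_toReal (hWne h)]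
  have hTT : FlatTorus.totalVariation L u ^ θ = ENNReal.ofReal (FlatTorus.tv L u ^ θ) := by
    rw [← ENNReal.ofReal_rpow_of_nonneg hT (by linarith), FlatTorus.tv,
      ENNReal.ofReal_toReal hu.2.ne]
  have hCC : ((√C).toNNReal : ℝ≥0∞) = ENNReal.ofReal √C := rfl
  rw [hWW, hTT, hCC, ← ENNReal.ofReal_mul (by positivity), ← ENNReal.ofReal_mul (by positivity),
    ENNReal.ofReal_rpow_of_nonneg (by positivity) (by norm_num), Real.mul_rpow hC.le (by positivity),
    Real.mul_rpow (by positivity) (by positivity), ← Real.rpow_mul hWr, ← Real.rpow_mul hT,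
    Real.sqrt_eq_rpow, (by ring : 2 * (1 - θ) * (1 / 2) = 1 - θ), (by ring : 2 * θ * (1 / 2) = θ),
    mul_assoc]
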